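/- \textbf{Model.} There are $k\ge 1$ sites, a coordinator, and a universe $[m]$. Site $i$ holds a vector $v^i\in\mathbb{Z}_{\ge 0}^m$, initially $0$. A fixed (oblivious) sequence of $n\ge 2$ updates arrives one by one, arbitrarily interleaved over the sites; an update $(i,j)$ increases $v^i_j$ by $1$ and is seen by site $i$ only. The protocol is randomized with public coins and \emph{one-way}: upon an update the site concerned may send a bit string to the coordinator, depending only on the coins and on the updates this site has received so far, and nothing is ever sent to a site. The coordinator's output is a bit determined by the coins and by the messages received so far. It is $0$ at first; once the coordinator sets it to $1$ it stays $1$ and the protocol terminates. The total communication is the number of bits sent until termination (all messages caused by the update at which the protocol terminates included), or during the whole stream if the protocol does not terminate. \textbf{Threshold problem.} Let $F_p=\bigl\|\sum_{i=1}^k v^i\bigr\|_p^p$. Given a threshold $\tau>0$ and $0<\varepsilon\le 1$, the output at a given time is \emph{correct} if it is $1$ when $F_p>\tau$ and $0$ when $F_p<\tau/(1+\varepsilon)$; it is arbitrary when $\tau/(1+\varepsilon)\le F_p\le\tau$. \textbf{Theorem.} For every real $p>1$ there are constants $C>0$ and $c\in\mathbb{N}$, depending only on $p$, such that for all integers $k\ge1$,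 $m$, $n\ge 2$ and all reals $0<\varepsilon\le 1$, $\tau>0$ there is a one-way protocol (which may depend on $p,k,m,n,\varepsilon,\tau$) with the following property. On every sequence of $n$ updates, with probability at least $2/3$, the coordinator's output is correct at all times $0,1,\dots,n$ and, simultaneously, the total communication is at most $$C\,k^{p-1}\,\bigl(\varepsilon^{-1}\log_2 n\bigr)^{c}$$ bits. In particular this holds when $n=\mathrm{poly}(m)$. -/

import Mathlib

namespace FpTracking

/-- A randomized one-way protocol for `k` sites, a coordinator and the universe `[m]`.
All randomness (public coins, and also the coins that only one party uses) is a point `ω` of a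
probability space, drawn once and independently of the input.  Whenever a site receives an update
it sends a bit string (possibly the empty one, i.e. nothing) to the coordinator; the string depends
only on `ω` and on the updates which that site has received so far.  Nothing is ever sent to a site.
The coordinator decides from `ω` and from the (nonempty) messages received so far, in order of
arrival and with their senders, whether to output `1`; it sees neither the global time nor the
updates that caused no message. -/
structure OneWayProtocol (k m : ℕ) where
  /-- the sample space of the coins -/
  Ω : Type
  [measurableSpace : MeasurableSpace Ω]
  /-- the distribution of the coins -/
  P : MeasureTheory.Measure Ω
  [isProbabilityMeasure : MeasureTheory.IsProbabilityMeasure P]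
  /-- `send ω i h` is what site `i` sends right after its local stream has become `h`
  (the last entry of `h` is the update just received) -/
  send : Ω → Fin k → List (Fin m) → List Bool
  /-- `decide1 ω T`: the coordinator outputs `1` once the messages received so far are `T` -/
  decide1 : Ω → List (Fin k × List Bool) → Bool
  measurableSet_send : ∀ i h w, MeasurableSet {ω | send ω i h = w}
  measurableSet_decide1 : ∀ T, MeasurableSet {ω | decide1 ω T = true}

variable {k m : ℕ}

/-- The union of the streams is a sequence `σ` of updates: the update `σ t = (i, j)` (the one with
index `t`, so the `(t+1)`-st) increments coordinate `j` at site `i`.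
`vec σ t i j` is the entry `v^i_j` after the first `t` updates. -/
def vec (σ : ℕ → Fin k × Fin m) (t : ℕ) (i : Fin k) (j : Fin m) : ℕ :=
  ((Finset.range t).filter (fun s => σ s = (i, j))).card

/-- `F_p = ‖∑ i, v^i‖_p^p` after the first `t` updates. -/
noncomputable def Fp (p : ℝ) (σ : ℕ → Fin k × Fin m) (t : ℕ) : ℝ :=
  ∑ j : Fin m, ((∑ i : Fin k, vec σ t i j : ℕ) : ℝ) ^ p

/-- The stream received by site `i` among the first `t` updates. -/
def localStream (σ : ℕ → Fin k × Fin m) (t : ℕ) (i : Fin k) : List (Fin m) :=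
  (((List.range t).map σ).filter (fun u => u.1 = i)).map Prod.snd

namespace OneWayProtocol

attribute [instance] OneWayProtocol.measurableSpace OneWayProtocol.isProbabilityMeasure

/-- The message caused by the update `σ t`; its sender is the site `(σ t).1`. -/
def message (Q : OneWayProtocol k m) (ω : Q.Ω) (σ : ℕ → Fin k × Fin m) (t : ℕ) : List Bool :=
  Q.send ω (σ t).1 (localStream σ (t + 1) (σ t).1)

/-- The nonempty messages caused by the first `t` updates, with their senders. -/
def received (Q : OneWayProtocol k m) (ω : Q.Ω) (σ : ℕ → Fin k × Fin m) (t : ℕ) :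
    List (Fin k × List Bool) :=
  ((List.range t).map (fun s => ((σ s).1, Q.message ω σ s))).filter (fun a => a.2 ≠ [])

/-- The coordinator's output after the first `t` updates (`true` is `1`).  The output is `0` until
the coordinator decides to output `1`; then the protocol terminates, and the output stays `1`. -/
def output (Q : OneWayProtocol k m) (ω : Q.Ω) (σ : ℕ → Fin k × Fin m) (t : ℕ) : Bool :=
  (List.range (t + 1)).any (fun s => Q.decide1 ω (Q.received ω σ s))

/-- The total number of bits sent during the first `n` updates: every message counts, up to and
including the one upon which the protocol terminates. -/
def communication (Q : OneWayProtocol k m) (ω : Q.Ω) (σ : ℕ → Fin k × Fin m) (n : ℕ) : ℕ :=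
  ∑ t ∈ Finset.range n, if Q.output ω σ t = true then 0 else (Q.message ω σ t).length

/-- The output after the first `t` updates is correct for the threshold problem:
it is `1` if `F_p > τ` and `0` if `F_p < τ / (1 + ε)` (and arbitrary in between). -/
def CorrectAt (Q : OneWayProtocol k m) (p ε τ : ℝ) (ω : Q.Ω) (σ : ℕ → Fin k × Fin m) (t : ℕ) :
    Prop :=
  (τ < Fp p σ t → Q.output ω σ t = true) ∧ (Fp p σ t < τ / (1 + ε) → Q.output ω σ t = false)

end OneWayProtocol

end FpTracking

/-! Write `f_j` for the total count of coordinate `j`, and let `T ^ p = τ`. A copy of a coordinate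
draws `u` uniformly from `(0, 1]` and gets the random scale `a = T * u ^ (1 / p)`, so that `f_j ≥ a`
has probability `min 1 (f_j ^ p / τ)`. With `R` independent copies of every coordinate, the expected
number of pairs whose count exceeds its scale is thus about `R * F_p / τ` as long as no coordinate
saturates, and at least `R` as soon as `F_p > τ`. The coordinator raises its output when about `R`
pairs have been detected; a Chernoff bound with `R` polynomial in `1 / ε` separates `F_p > τ` from
`F_p < τ / (1 + ε)`.

To detect `f_j ≥ a` cheaply, an increment is reported with probability `min 1 (L / a)`, and only if
its local index satisfies `k * (l + 1) ≥ δ * a`. Each site thereby drops at most `δ * a / k`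
increments, all sites together at most `δ * a`. A missed detection has probability at most `δ`
(`measureReal_compl_detectSet_le`). False detections must remain negligible after summation over all
coordinates, however small their counts; so their probability is bounded by `δ` times the power `2 *
p` of `f_j / a`, up to constants (`measureReal_detectSet_le`), which integrates over the scale to
`O(δ * f_j ^ p / τ)` (`blockMeasure_detect_le`).

Dropping early increments controls the cost. Increment `l` can be reported only for scales up to `k
* (l + 1) / δ`, and integrating `L / a` over these gives a multiple of `(k * (l + 1)) ^ (p - 1) / T
^ p` (`blockMeasure_kept_le`). The sum over the increments of coordinate `j` is at most a multiple
of `k ^ (p - 1) * f_j ^ p / τ`, and the sum over `j` is a multiple of `k ^ (p - 1)` while `F_p =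
O(τ)`.

No union bound over time is needed: detections only accumulate, so it suffices to control the last
time with `F_p < τ / (1 + ε)` and the first time with `F_p > τ`, both determined by the oblivious
stream. Finally, hashing the universe to `O(n ^ 2)` names makes every message short, and thresholds
below `1` are trivial. -/

namespace FpTracking

open MeasureTheory

/-! ### Chernoff bounds for counts of independent events. -/

section Chernoff

variable {ι X : Type*} [Fintype ι]

open Classical in
/-- The number of indices `i` with `ω i ∈ A i`. -/
noncomputable def hits (A : ι → Set X) (ω : ι → X) : ℕ :=
  (Finset.univ.filter (fun i => ω i ∈ A i)).card

lemma pow_hits (A : ι → Set X) (ω : ι → X) (s : ℝ) :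
    s ^ hits A ω = ∏ i, (1 + (A i).indicator (fun _ => s - 1) (ω i)) := by
  classical
  unfold hits
  rw [Finset.card_eq_sum_ones, ← Finset.prod_pow_eq_pow_sum, Finset.prod_filter]
  refine Finset.prod_congr rfl fun i _ => ?_
  by_cases h : ω i ∈ A i <;> simp [h]

lemma hits_mono {A B : ι → Set X} {ω : ι → X} (h : ∀ i, ω i ∈ A i → ω i ∈ B i) :
    hits A ω ≤ hits B ω := by
  classical
  exact Finset.card_le_card (Finset.monotone_filter_right _ fun i _ => h i)

lemma hits_congr {A B : ι → Set X} {ω : ι → X} (h : ∀ i, ω i ∈ A i ↔ ω i ∈ B i) :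
    hits A ω = hits B ω :=
  le_antisymm (hits_mono fun i => (h i).1) (hits_mono fun i => (h i).2)

lemma hits_le_card (A : ι → Set X) (ω : ι → X) : hits A ω ≤ Fintype.card ι := by
  classical exact Finset.card_filter_le _ _

variable [MeasurableSpace X] (β : Measure X) [IsProbabilityMeasure β]

lemma integral_one_add_indicator {A : Set X} (hA : MeasurableSet A) (s : ℝ) :
    ∫ x, (1 + A.indicator (fun _ => s - 1) x) ∂β = 1 + (s - 1) * β.real A := by
  rw [integral_add (integrable_const _) ((integrable_const _).indicator hA),
    integral_indicator_const _ hA]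
  simp [mul_comm]

lemma measurable_hits {A : ι → Set X} (hA : ∀ i, MeasurableSet (A i)) :
    Measurable (hits A) := by
  classical
  have : hits A = fun ω => ∑ i, if ω i ∈ A i then 1 else 0 := by
    ext ω; simp [hits]
  rw [this]
  refine Finset.measurable_sum _ fun i _ => ?_
  exact Measurable.ite ((measurable_pi_apply i) (hA i)) measurable_const measurable_const

lemma integrable_pow_hits {A : ι → Set X} (hA : ∀ i, MeasurableSet (A i)) {s : ℝ} (hs : 0 ≤ s) :
    Integrable (fun ω => s ^ hits A ω) (Measure.pi fun _ : ι => β) := by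
  refine Integrable.of_bound (C := (max s 1) ^ Fintype.card ι) ?_ (ae_of_all _ fun ω => ?_)
  · exact ((measurable_of_countable (fun n : ℕ => s ^ n)).comp
      (measurable_hits hA)).aestronglyMeasurable
  · rw [Real.norm_of_nonneg (by positivity)]
    calc s ^ hits A ω ≤ (max s 1) ^ hits A ω := by gcongr; exact le_max_left _ _
      _ ≤ _ := pow_le_pow_right₀ (le_max_right _ _) (hits_le_card A ω)

/-- Independence turns the generating function into a product, and each factor is bounded by `1 + x
≤ exp x`. -/
lemma integral_pow_hits_le {A : ι → Set X} (hA : ∀ i, MeasurableSet (A i)) {s : ℝ} (hs : 0 ≤ s) :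
    ∫ ω, s ^ hits A ω ∂(Measure.pi fun _ : ι => β) ≤
      Real.exp ((s - 1) * ∑ i, β.real (A i)) := by
  simp_rw [pow_hits]
  rw [integral_fintype_prod_eq_prod (𝕜 := ℝ)
    (fun i x => 1 + (A i).indicator (fun _ => s - 1) x), Finset.mul_sum, Real.exp_sum]
  refine Finset.prod_le_prod (fun i _ => ?_) (fun i _ => ?_)
  · refine integral_nonneg fun x => ?_
    by_cases h : x ∈ A i <;> simp [h, hs]
  · rw [integral_one_add_indicator β (hA i), add_comm]
    exact Real.add_one_le_exp _

/-- Chernoff bound for the upper tail of a sum of independent indicators. -/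
lemma measureReal_le_hits {A : ι → Set X} (hA : ∀ i, MeasurableSet (A i)) {s c M : ℝ}
    (hs : 1 ≤ s) (hM : ∑ i, β.real (A i) ≤ M) :
    (Measure.pi fun _ : ι => β).real {ω | c ≤ hits A ω} ≤ s ^ (-c) * Real.exp ((s - 1) * M) := by
  have h0 : 0 < s := by linarith
  have h := mul_meas_ge_le_integral_of_nonneg (μ := Measure.pi fun _ : ι => β)
    (f := fun ω => s ^ hits A ω) (ae_of_all _ fun ω => by positivity)
    (integrable_pow_hits β hA h0.le) (s ^ c)
  have h2 : (Measure.pi fun _ : ι => β).real {ω | c ≤ hits A ω} ≤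
      (Measure.pi fun _ : ι => β).real {ω | s ^ c ≤ s ^ hits A ω} := by
    refine measureReal_mono fun ω hω => ?_
    simp only [Set.mem_ofPred_eq] at hω ⊢
    rw [← Real.rpow_natCast]
    exact Real.rpow_le_rpow_of_exponent_le hs hω
  have h3 := integral_pow_hits_le β hA h0.le
  have h4 : Real.exp ((s - 1) * ∑ i, β.real (A i)) ≤ Real.exp ((s - 1) * M) := by
    gcongr
  rw [Real.rpow_neg h0.le, ← div_eq_inv_mul, le_div_iff₀ (by positivity), mul_comm]
  exact (mul_le_mul_of_nonneg_left h2 (by positivity)).trans (h.trans (h3.trans h4))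

/-- Chernoff bound for the lower tail of a sum of independent indicators. -/
lemma measureReal_hits_le {A : ι → Set X} (hA : ∀ i, MeasurableSet (A i)) {s c M : ℝ}
    (hs0 : 0 < s) (hs : s ≤ 1) (hM : M ≤ ∑ i, β.real (A i)) :
    (Measure.pi fun _ : ι => β).real {ω | hits A ω ≤ c} ≤ s ^ (-c) * Real.exp ((s - 1) * M) := by
  have h := mul_meas_ge_le_integral_of_nonneg (μ := Measure.pi fun _ : ι => β)
    (f := fun ω => s ^ hits A ω) (ae_of_all _ fun ω => by positivity)
    (integrable_pow_hits β hA hs0.le) (s ^ c)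
  have h2 : (Measure.pi fun _ : ι => β).real {ω | hits A ω ≤ c} ≤
      (Measure.pi fun _ : ι => β).real {ω | s ^ c ≤ s ^ hits A ω} := by
    refine measureReal_mono fun ω hω => ?_
    simp only [Set.mem_ofPred_eq] at hω ⊢
    rw [← Real.rpow_natCast]
    exact Real.rpow_le_rpow_of_exponent_ge hs0 hs hω
  have h3 := integral_pow_hits_le β hA hs0.le
  have h4 : Real.exp ((s - 1) * ∑ i, β.real (A i)) ≤ Real.exp ((s - 1) * M) := by
    rw [Real.exp_le_exp]
    exact mul_le_mul_of_nonpos_left hM (by linarith)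
  rw [Real.rpow_neg hs0.le, ← div_eq_inv_mul, le_div_iff₀ (by positivity), mul_comm]
  exact (mul_le_mul_of_nonneg_left h2 (by positivity)).trans (h.trans (h3.trans h4))

/-- If the expected number of hits is at least `(1 - e) B`, then it is unlikely that there are at
most `(1 - 2 e) B` hits. -/
lemma measureReal_hits_le_exp {A : ι → Set X} (hA : ∀ i, MeasurableSet (A i)) {e B : ℝ}
    (he0 : 0 < e) (he : e ≤ 1 / 2) (hB : 0 ≤ B) (hM : (1 - e) * B ≤ ∑ i, β.real (A i)) :
    (Measure.pi fun _ : ι => β).real {ω | hits A ω ≤ (1 - 2 * e) * B} ≤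
      Real.exp (-(e ^ 3 * B)) := by
  refine (measureReal_hits_le β hA (s := 1 - e) (by linarith) (by linarith) hM).trans ?_
  have h1 : 0 < 1 - e := by linarith
  rw [Real.rpow_def_of_pos h1, ← Real.exp_add, Real.exp_le_exp]
  have h2 := Real.one_sub_inv_le_log_of_pos h1
  have h3 : 1 - (1 - e)⁻¹ = - e / (1 - e) := by field_simp; ring
  rw [h3] at h2
  have h4 : -(Real.log (1 - e)) * ((1 - 2 * e) * B) ≤ e / (1 - e) * ((1 - 2 * e) * B) := by
    refine mul_le_mul_of_nonneg_right ?_ (mul_nonneg (by linarith) hB)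
    rw [neg_div] at h2; linarith
  -- The first two orders in `e` cancel because `(1 - e) ^ 2 = (1 - 2 * e) + e ^ 2`; this is why the
  -- exponent is only cubic.
  have h5 : e / (1 - e) * ((1 - 2 * e) * B) + (1 - e - 1) * ((1 - e) * B) =
      - (e ^ 3 * B) / (1 - e) := by field_simp; ring
  have h6 : - (e ^ 3 * B) / (1 - e) ≤ -(e ^ 3 * B) := by
    rw [div_le_iff₀ h1]
    have : 0 ≤ e ^ 3 * B := by positivity
    nlinarith
  linarith

/-- If the expected number of hits is at most `(1 - 4 e) B`, then it is unlikely that there are at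
least `(1 - 2 e) B` hits. -/
lemma measureReal_le_hits_exp {A : ι → Set X} (hA : ∀ i, MeasurableSet (A i)) {e B : ℝ}
    (he0 : 0 < e) (he : e ≤ 1 / 2) (hB : 0 ≤ B) (hM : ∑ i, β.real (A i) ≤ (1 - 4 * e) * B) :
    (Measure.pi fun _ : ι => β).real {ω | (1 - 2 * e) * B ≤ hits A ω} ≤
      Real.exp (-(e ^ 2 * B)) := by
  refine (measureReal_le_hits β hA (s := 1 + e) (by linarith) hM).trans ?_
  have h1 : 0 < 1 + e := by linarith
  rw [Real.rpow_def_of_pos h1, ← Real.exp_add, Real.exp_le_exp]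
  have h2 := Real.one_sub_inv_le_log_of_pos h1
  have h3 : e * (1 - e) ≤ 1 - (1 + e)⁻¹ := by
    rw [show 1 - (1 + e)⁻¹ = e / (1 + e) by field_simp; ring, le_div_iff₀ h1]
    nlinarith [pow_pos he0 3]
  have h4 : (e * (1 - e)) * ((1 - 2 * e) * B) ≤ Real.log (1 + e) * ((1 - 2 * e) * B) :=
    mul_le_mul_of_nonneg_right (h3.trans h2) (mul_nonneg (by linarith) hB)
  have : 0 ≤ e ^ 3 * B := by positivity
  nlinarith

end Chernoff

/-! ### Detecting that one coordinate exceeds a fixed scale. -/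

section Block

/-- The increment with (zero-based) local index `l` is reported in a copy with scale `a` and coin
`c`. -/
def Kept (k : ℕ) (δ L a : ℝ) (l : ℕ) (c : unitInterval) : Prop := δ * a ≤ k * (l + 1) ∧ (c : ℝ) * a ≤ L

variable {k n : ℕ}

/-- The coins of the reported increments, if site `i` has received `v i` increments. -/
def keptSet (δ L a : ℝ) (v : Fin k → ℕ) (x : Fin k × Fin n) : Set unitInterval :=
  {c | x.2 < v x.1 ∧ Kept k δ L a x.2 c}

/-- The coins for which the scale `a` is found to be exceeded. -/
def detectSet (δ L a : ℝ) (v : Fin k → ℕ) : Set (Fin k × Fin n → unitInterval) :=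
  {c | (1 - 2 * δ) * min L a ≤ hits (keptSet δ L a v) c}

lemma measurableSet_kept (δ L a : ℝ) (l : ℕ) : MeasurableSet {c | Kept k δ L a l c} := by
  have h : MeasurableSet {c : unitInterval | (c : ℝ) * a ≤ L} :=
    measurableSet_le (by fun_prop) measurable_const
  exact (MeasurableSet.const (δ * a ≤ k * ((l : ℝ) + 1))).inter h

lemma measurableSet_keptSet (δ L a : ℝ) (v : Fin k → ℕ) (x : Fin k × Fin n) :
    MeasurableSet (keptSet δ L a v x) :=
  (MeasurableSet.const _).inter (measurableSet_kept δ L a x.2)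

lemma volume_real_coin {a L : ℝ} (ha : 0 < a) (hL : 0 < L) :
    (volume : Measure unitInterval).real {c | (c : ℝ) * a ≤ L} = min 1 (L / a) := by
  have h : {c : unitInterval | (c : ℝ) * a ≤ L} =
      Set.Iic (⟨min 1 (L / a), le_min zero_le_one (by positivity), min_le_left _ _⟩ : unitInterval) := by
    ext c
    rw [Set.mem_Iic, ← Subtype.coe_le_coe, le_min_iff, le_div_iff₀ ha]
    exact ⟨fun h => ⟨c.2.2, h⟩, fun h => h.2⟩
  rw [h, measureReal_def, unitInterval.volume_Iic, ENNReal.toReal_ofReal]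
  exact le_min zero_le_one (by positivity)

/-- The number of increments which are late enough to be reported. -/
lemma sum_late_ge {δ a : ℝ} (hk : 0 < k) (hδ : 0 ≤ δ) (ha : 0 ≤ a) {v : Fin k → ℕ}
    (hv : ∀ i, v i ≤ n) :
    ((∑ i, v i : ℕ) : ℝ) - δ * a ≤
      ((Finset.univ.filter fun x : Fin k × Fin n =>
        x.2 < v x.1 ∧ δ * a ≤ k * ((x.2 : ℕ) + 1)).card : ℝ) := by
  classical
  have hk' : (0 : ℝ) < k := by exact_mod_cast hk
  -- Every index from `q` on is late enough, so a site loses at most `q ≤ δ * a / k` increments;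
  -- over `k` sites this adds up to `δ * a`.
  set q := ⌊δ * a / k⌋₊ with hq
  have h1 : ∀ i, v i - q ≤ (Finset.univ.filter fun l : Fin n =>
      (l : ℕ) < v i ∧ δ * a ≤ k * (((l : Fin n) : ℕ) + 1)).card := by
    intro i
    have : ((Finset.Ico q (v i)).attachFin fun l hl =>
        (Finset.mem_Ico.1 hl).2.trans_le (hv i)) ⊆ (Finset.univ.filter fun l : Fin n =>
      (l : ℕ) < v i ∧ δ * a ≤ k * (((l : Fin n) : ℕ) + 1)) := by
      intro l hl
      simp only [Finset.mem_attachFin, Finset.mem_Ico] at hl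
      simp only [Finset.mem_filter, Finset.mem_univ, true_and]
      refine ⟨hl.2, ?_⟩
      have h2 := Nat.lt_floor_add_one (δ * a / k)
      rw [← hq, div_lt_iff₀ hk'] at h2
      have h3 : (q : ℝ) ≤ (l : ℕ) := by exact_mod_cast hl.1
      nlinarith
    have h2 := Finset.card_le_card this
    rwa [Finset.card_attachFin, Nat.card_Ico] at h2
  have h2 : (Finset.univ.filter fun x : Fin k × Fin n =>
        x.2 < v x.1 ∧ δ * a ≤ k * ((x.2 : ℕ) + 1)).card = ∑ i, (Finset.univ.filter fun l : Fin n =>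
      (l : ℕ) < v i ∧ δ * a ≤ k * (((l : Fin n) : ℕ) + 1)).card := by
    simp_rw [Finset.card_filter]
    rw [Fintype.sum_prod_type]
  rw [h2]
  have h3 : ∑ i, ((v i : ℝ) - δ * a / k) ≤ ∑ i, ((Finset.univ.filter fun l : Fin n =>
      (l : ℕ) < v i ∧ δ * a ≤ k * (((l : Fin n) : ℕ) + 1)).card : ℝ) := by
    refine Finset.sum_le_sum fun i _ => ?_
    have h4 : (q : ℝ) ≤ δ * a / k := Nat.floor_le (by positivity)
    have h5 : (v i : ℝ) ≤ (v i - q : ℕ) + q := by exact_mod_cast (by omega)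
    have h6 : ((v i - q : ℕ) : ℝ) ≤ _ := Nat.cast_le.2 (h1 i)
    linarith
  rw [Finset.sum_sub_distrib] at h3
  simp only [Finset.sum_const, Finset.card_univ, Fintype.card_fin, nsmul_eq_mul] at h3
  rw [mul_div_cancel₀ _ hk'.ne'] at h3
  push_cast
  exact h3

lemma hits_keptSet_le {δ L a : ℝ} (v : Fin k → ℕ) (c : Fin k × Fin n → unitInterval) :
    hits (keptSet δ L a v) c ≤ ∑ i, v i := by
  classical
  unfold hits
  calc _ ≤ (Finset.univ.filter fun x : Fin k × Fin n => x.2 < v x.1).card := by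
        refine Finset.card_le_card fun x hx => ?_
        simp only [Finset.mem_filter, Finset.mem_univ, true_and] at hx ⊢
        exact hx.1
    _ = ∑ i, (Finset.univ.filter fun l : Fin n => (l : ℕ) < v i).card := by
        simp_rw [Finset.card_filter]
        rw [Fintype.sum_prod_type]
    _ ≤ _ := by
        refine Finset.sum_le_sum fun i _ => ?_
        rw [Fin.card_filter_val_lt]
        exact min_le_right _ _

lemma measureReal_keptSet {δ L a : ℝ} (ha : 0 < a) (hL : 0 < L) (v : Fin k → ℕ)
    (x : Fin k × Fin n) [Decidable (x.2 < v x.1 ∧ δ * a ≤ k * ((x.2 : ℕ) + 1))] :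
    (volume : Measure unitInterval).real (keptSet δ L a v x) =
      if x.2 < v x.1 ∧ δ * a ≤ k * ((x.2 : ℕ) + 1) then min 1 (L / a) else 0 := by
  split_ifs with h
  · rw [← volume_real_coin ha hL]
    congr 1
    ext c
    exact ⟨fun h' => h'.2.2, fun h' => ⟨h.1, h.2, h'⟩⟩
  · have : keptSet δ L a v x = ∅ := by
      ext c
      simp only [Set.mem_empty_iff_false, iff_false]
      exact fun h' => h ⟨h'.1, h'.2.1⟩
    rw [this]; simp

lemma sum_measureReal_keptSet_ge {δ L a : ℝ} (hk : 0 < k) (hδ : 0 ≤ δ) (ha : 0 < a) (hL : 0 < L)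
    {v : Fin k → ℕ} (hv : ∀ i, v i ≤ n) :
    (((∑ i, v i : ℕ) : ℝ) - δ * a) * min 1 (L / a) ≤
      ∑ x : Fin k × Fin n, (volume : Measure unitInterval).real (keptSet δ L a v x) := by
  classical
  simp_rw [measureReal_keptSet ha hL]
  rw [← Finset.sum_filter, Finset.sum_const, nsmul_eq_mul]
  exact mul_le_mul_of_nonneg_right (sum_late_ge hk hδ ha.le hv)
    (le_min zero_le_one (by positivity))

lemma sum_measureReal_keptSet_le {δ L a : ℝ} (ha : 0 < a) (hL : 0 < L) {v : Fin k → ℕ} :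
    ∑ x : Fin k × Fin n, (volume : Measure unitInterval).real (keptSet δ L a v x) ≤
      ((∑ i, v i : ℕ) : ℝ) * (L / a) := by
  classical
  calc _ ≤ ∑ x : Fin k × Fin n, (if (x.2 : ℕ) < v x.1 then L / a else 0) := by
        refine Finset.sum_le_sum fun x _ => ?_
        rw [measureReal_keptSet ha hL]
        split_ifs with h1 h2 h2
        · exact min_le_right _ _
        · exact absurd h1.1 h2
        · positivity
        · exact le_rfl
    _ = ∑ i : Fin k, ((Finset.univ.filter fun l : Fin n => (l : ℕ) < v i).card : ℝ) * (L / a) := by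
        rw [Fintype.sum_prod_type]
        refine Finset.sum_congr rfl fun i _ => ?_
        rw [← Finset.sum_filter, Finset.sum_const, nsmul_eq_mul]
    _ ≤ _ := by
        rw [← Finset.sum_mul]
        refine mul_le_mul_of_nonneg_right ?_ (by positivity)
        push_cast
        refine Finset.sum_le_sum fun i _ => ?_
        rw [Fin.card_filter_val_lt]
        exact_mod_cast min_le_right _ _

/-- The measure of the coins of one copy of a coordinate. -/
noncomputable abbrev coinMeasure (k n : ℕ) : Measure (Fin k × Fin n → unitInterval) :=
  Measure.pi fun _ => (volume : Measure unitInterval)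

/-- No missed detections: dropping early increments costs a factor `1 - δ` in the mean, which leaves
room down to `1 - 2 * δ`. If `a ≤ L`, nothing is subsampled and detection is certain. Otherwise the
mean is at least `(1 - δ) * L` and the lower tail applies; `L = δ⁻¹ ^ 4` makes its exponent `-δ⁻¹`.
-/
lemma measureReal_compl_detectSet_le {δ L a : ℝ} (hk : 0 < k) (hδ : 0 < δ) (hδ' : δ ≤ 1 / 8)
    (hL : L = δ⁻¹ ^ 4) (ha : 0 < a) {v : Fin k → ℕ} (hv : ∀ i, v i ≤ n)
    (hav : a ≤ (∑ i, v i : ℕ)) :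
    (coinMeasure k n).real (detectSet δ L a v)ᶜ ≤ δ := by
  have hL0 : 0 < L := by rw [hL]; positivity
  rcases le_or_gt a L with h | h
  · have : (detectSet δ L a v)ᶜ = (∅ : Set (Fin k × Fin n → unitInterval)) := by
      classical
      rw [Set.compl_empty_iff, Set.eq_univ_iff_forall]
      intro c
      change (1 - 2 * δ) * min L a ≤ hits (keptSet δ L a v) c
      rw [min_eq_right h]
      have h1 := sum_late_ge hk hδ.le ha.le hv
      have h2 : (hits (keptSet δ L a v) c : ℝ) = ((Finset.univ.filter fun x : Fin k × Fin n =>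
        x.2 < v x.1 ∧ δ * a ≤ k * ((x.2 : ℕ) + 1)).card : ℝ) := by
        unfold hits
        congr 2
        ext x
        simp only [Finset.mem_filter, Finset.mem_univ, true_and]
        refine ⟨fun h => ⟨h.1, h.2.1⟩, fun h' => ⟨h'.1, h'.2, ?_⟩⟩
        -- A coin is at most `1` and `a ≤ L`, so the coin condition is vacuous.
        have := (c x).2.2
        nlinarith
      rw [h2]
      refine le_trans ?_ h1
      nlinarith
    rw [this]; simp [hδ.le]
  · have h1 := sum_measureReal_keptSet_ge hk hδ.le ha hL0 hv
    have h2 : min 1 (L / a) = L / a := min_eq_right ((div_le_one ha).2 h.le)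
    rw [h2] at h1
    have h3 : (1 - δ) * L ≤ ((∑ i, v i : ℕ) - δ * a) * (L / a) := by
      rw [mul_div_assoc', le_div_iff₀ ha]
      nlinarith
    have h4 := measureReal_hits_le_exp volume (measurableSet_keptSet δ L a v) hδ (by linarith)
      hL0.le (h3.trans h1)
    have h5 : (detectSet δ L a v)ᶜ ⊆ {ω : Fin k × Fin n → unitInterval |
        hits (keptSet δ L a v) ω ≤ (1 - 2 * δ) * L} := by
      intro c hc
      have : ¬ ((1 - 2 * δ) * min L a ≤ hits (keptSet δ L a v) c) := hc
      rw [min_eq_left h.le, not_le] at this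
      exact this.le
    refine (measureReal_mono h5).trans (h4.trans ?_)
    have h6 : δ ^ 3 * L = δ⁻¹ := by rw [hL]; field_simp
    rw [h6, Real.exp_neg]
    refine inv_le_of_inv_le₀ hδ ?_
    linarith [Real.add_one_le_exp δ⁻¹]

/-- The analytic core of the false-detection bound: a Chernoff expression with threshold `(1 - 2 *
δ) * L`, mean `w ^ 2` times that threshold, and base `w⁻¹`. The huge `L` pays both for the factor
`δ` and for the polynomial decay in `w`. -/
lemma rpow_mul_exp_le {δ L p w : ℝ} (hδ : 0 < δ) (hδ' : δ ≤ 1 / 8)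
    (hδp : 8 * p * δ ≤ 1) (hL : L = δ⁻¹ ^ 4) (hw0 : 0 < w) (hw1 : w ≤ 1 - δ) :
    w⁻¹ ^ (-((1 - 2 * δ) * L)) * Real.exp ((w⁻¹ - 1) * (L * (1 - 2 * δ) * w ^ 2)) ≤
      δ * (w ^ 2) ^ (2 * p) := by
  have hL0 : 0 < L := by rw [hL]; positivity
  set b := 1 - 2 * δ with hb
  have hb0 : 0 < b := by linarith
  have hR : (w ^ 2) ^ (2 * p) = Real.exp (Real.log w * (4 * p)) := by
    rw [← Real.rpow_natCast w 2, ← Real.rpow_mul hw0.le, Real.rpow_def_of_pos hw0]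
    push_cast
    ring_nf
  rw [hR]
  have hlog : Real.log w ≤ - δ := by
    linarith [Real.log_le_sub_one_of_pos hw0]
  have hlog2 : Real.log w ≤ w - 1 := Real.log_le_sub_one_of_pos hw0
  rw [Real.rpow_def_of_pos (inv_pos.2 hw0), Real.log_inv,
    ← Real.exp_add]
  have h3 : Real.exp (-δ⁻¹) ≤ δ := by
    rw [Real.exp_neg]
    refine inv_le_of_inv_le₀ hδ ?_
    linarith [Real.add_one_le_exp δ⁻¹]
  refine le_trans ?_ (mul_le_mul_of_nonneg_right h3 (Real.exp_pos _).le)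
  rw [← Real.exp_add, Real.exp_le_exp]
  have h4 : (w⁻¹ - 1) * (L * b * w ^ 2) = L * b * (w * (1 - w)) := by
    field_simp
  rw [h4]
  -- Since `1 - w ≤ -log w`, the left side is at most `(1 - w) * log w`; then `1 - w ≥ δ` and `log w
  -- < 0`.
  have h5 : Real.log w + w * (1 - w) ≤ δ * Real.log w := by nlinarith
  have h6 : L * b * (Real.log w + w * (1 - w)) ≤ L * b * (δ * Real.log w) :=
    mul_le_mul_of_nonneg_left h5 (by positivity)
  -- The exponent `L * b * δ * log w` is split: `4 * p * log w` gives the desired power, and the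
  -- rest is at most `-δ⁻¹` because `log w ≤ -δ`.
  have h7 : δ⁻¹ ≤ (L * b * δ - 4 * p) * δ := by
    have : L * b * δ * δ = b * (δ⁻¹ * δ⁻¹) := by rw [hL]; field_simp
    have h8 : 8 ≤ δ⁻¹ := by
      rw [le_inv_comm₀ (by norm_num) hδ]; linarith
    have h9 : 3 / 4 ≤ b := by linarith
    nlinarith
  have h10 : (0:ℝ) < L * b * δ - 4 * p := by
    by_contra hcon
    have : 0 < δ⁻¹ := by positivity
    nlinarith
  nlinarith

/-- A bound by `δ` alone would be useless after summing over the whole universe, so the probability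
must decay with the count. The exponent `2 * p` leaves `u ^ (-2)`, integrable at infinity, once `a`
is replaced by the random scale. For `a ≤ L` or a zero count, detection is impossible because the
hits never exceed the count. -/
lemma measureReal_detectSet_le {δ L a p : ℝ} (hδ : 0 < δ) (hδ' : δ ≤ 1 / 8)
    (hδp : 8 * p * δ ≤ 1) (hL : L = δ⁻¹ ^ 4) (ha : 0 < a) {v : Fin k → ℕ}
    (hav : ((∑ i, v i : ℕ) : ℝ) < (1 - 2 * δ) ^ 2 * a) :
    (coinMeasure k n).real (detectSet δ L a v) ≤
      δ * ((∑ i, v i : ℕ) / ((1 - 2 * δ) * a)) ^ (2 * p) := by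
  have hL0 : 0 < L := by rw [hL]; positivity
  set f : ℝ := ((∑ i, v i : ℕ) : ℝ) with hf
  have hf0 : 0 ≤ f := Nat.cast_nonneg _
  set b := 1 - 2 * δ with hb
  have hb0 : 0 < b := by linarith
  have hb1 : b ≤ 1 := by linarith
  have hsmall : f < b * a := hav.trans_le (by nlinarith)
  have hempty : (∀ c : Fin k × Fin n → unitInterval, c ∉ detectSet δ L a v) →
      (coinMeasure k n).real (detectSet δ L a v) ≤ δ * (f / (b * a)) ^ (2 * p) := by
    intro h
    rw [Set.eq_empty_of_forall_notMem h, measureReal_empty]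
    positivity
  have hcnt : ∀ c : Fin k × Fin n → unitInterval, (hits (keptSet δ L a v) c : ℝ) ≤ f := fun c =>
    Nat.cast_le.2 (hits_keptSet_le v c)
  rcases le_or_gt a L with h | h
  · refine hempty fun c hc => ?_
    have : b * min L a ≤ hits (keptSet δ L a v) c := hc
    rw [min_eq_right h] at this
    linarith [hcnt c]
  rcases hf0.eq_or_lt with h0 | h0
  · refine hempty fun c hc => ?_
    have : b * min L a ≤ hits (keptSet δ L a v) c := hc
    have h1 : 0 < b * min L a := mul_pos hb0 (lt_min hL0 ha)
    linarith [hcnt c]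
  -- The mean is at most `w ^ 2` times the threshold `b * L`. The base `w⁻¹` is the square root of
  -- the optimal one and already suffices.
  set w := Real.sqrt (f / (b * a)) with hw
  have hr0 : 0 < f / (b * a) := by positivity
  have hw0 : 0 < w := Real.sqrt_pos.2 hr0
  have hw2 : w ^ 2 = f / (b * a) := Real.sq_sqrt hr0.le
  have hrb : f / (b * a) ≤ b := by
    rw [div_le_iff₀ (by positivity)]; nlinarith
  have hw1 : w ≤ 1 - δ := by
    rw [hw, Real.sqrt_le_left (by linarith)]
    nlinarith
  have hfy : f * (L / a) = L * b * w ^ 2 := by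
    rw [hw2]; field_simp
  have h1 := measureReal_le_hits (ι := Fin k × Fin n) volume (measurableSet_keptSet δ L a v) (s := w⁻¹)
    (c := b * L) ((one_le_inv₀ hw0).2 (by linarith)) (sum_measureReal_keptSet_le ha hL0)
  rw [← hf, hfy] at h1
  have h2 : detectSet δ L a v ⊆ {ω : Fin k × Fin n → unitInterval | b * L ≤ hits (keptSet δ L a v) ω} := by
    intro c hc
    have : b * min L a ≤ hits (keptSet δ L a v) c := hc
    rwa [min_eq_left h.le] at this
  refine (measureReal_mono h2).trans (h1.trans ?_)
  rw [← hw2]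
  exact rpow_mul_exp_le hδ hδ' hδp hL hw0 hw1

end Block

/-! ### Averaging over the random scale. -/

section Randomness

variable {k n : ℕ}

/-- The randomness of one copy of a coordinate: a random scale and the coins. -/
abbrev Block (k n : ℕ) : Type := ℝ × (Fin k × Fin n → unitInterval)

/-- The distribution of the randomness of one copy of a coordinate. -/
noncomputable def blockMeasure (k n : ℕ) : Measure (Block k n) :=
  (volume.restrict (Set.Ioc (0 : ℝ) 1)).prod (coinMeasure k n)

instance : IsProbabilityMeasure (volume.restrict (Set.Ioc (0 : ℝ) 1)) :=
  ⟨by simp⟩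

instance : IsProbabilityMeasure (blockMeasure k n) := by
  unfold blockMeasure; infer_instance

lemma integrableOn_coinMeasure_real {S : Set (Block k n)} (hS : MeasurableSet S) :
    IntegrableOn (fun u => (coinMeasure k n).real (Prod.mk u ⁻¹' S)) (Set.Ioc 0 1) := by
  refine Integrable.of_bound (C := 1) ?_ (ae_of_all _ fun u => ?_)
  · exact (measurable_measure_prodMk_left hS).ennreal_toReal.aestronglyMeasurable
  · rw [Real.norm_of_nonneg measureReal_nonneg]; exact measureReal_le_one

lemma blockMeasure_real {S : Set (Block k n)} (hS : MeasurableSet S) :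
    (blockMeasure k n).real S =
      ∫ u in Set.Ioc (0 : ℝ) 1, (coinMeasure k n).real (Prod.mk u ⁻¹' S) := by
  rw [measureReal_def, blockMeasure, Measure.prod_apply hS, ← integral_toReal]
  · rfl
  · exact (measurable_measure_prodMk_left hS).aemeasurable
  · exact ae_of_all _ fun u => measure_lt_top _ _

/-- Enlarging the range of `u` from `(0, 1]` to the half-line avoids a distinction of whether the
cut-off point of the bound lies below `1`. -/
lemma blockMeasure_real_le {S : Set (Block k n)} (hS : MeasurableSet S) {g : ℝ → ℝ}
    (hg : IntegrableOn g (Set.Ioi 0)) (hg0 : ∀ u, 0 < u → 0 ≤ g u)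
    (h : ∀ u, 0 < u → (coinMeasure k n).real (Prod.mk u ⁻¹' S) ≤ g u) :
    (blockMeasure k n).real S ≤ ∫ u in Set.Ioi 0, g u := by
  rw [blockMeasure_real hS]
  have hsub : Set.Ioc (0 : ℝ) 1 ⊆ Set.Ioi 0 := Set.Ioc_subset_Ioi_self
  refine (setIntegral_mono_on (integrableOn_coinMeasure_real hS) (hg.mono_set hsub)
    measurableSet_Ioc fun u hu => h u hu.1).trans ?_
  refine setIntegral_mono_set hg ?_ hsub.eventuallyLE
  exact (ae_restrict_mem measurableSet_Ioi).mono fun u hu => hg0 u hu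

/-- The threshold belonging to a uniformly distributed `u`. -/
noncomputable def scale (p T u : ℝ) : ℝ := T * u ^ (1 / p)

lemma scale_pos {p T u : ℝ} (hT : 0 < T) (hu : 0 < u) : 0 < scale p T u := by
  unfold scale; positivity

lemma scale_rpow {p T u : ℝ} (hp : 0 < p) (hT : 0 < T) (hu : 0 < u) :
    scale p T u ^ p = T ^ p * u := by
  rw [scale, Real.mul_rpow hT.le (by positivity), ← Real.rpow_mul hu.le, one_div,
    inv_mul_cancel₀ hp.ne', Real.rpow_one]

lemma measurable_scale (p T : ℝ) : Measurable (scale p T) := by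
  unfold scale; fun_prop

/-- The randomness with which increment `x` is reported. -/
def blockKept (p T δ L : ℝ) (x : Fin k × Fin n) : Set (Block k n) :=
  {b | Kept k δ L (scale p T b.1) x.2 (b.2 x)}

/-- The randomness with which the coordinate is detected. -/
def blockDetect (p T δ L : ℝ) (v : Fin k → ℕ) : Set (Block k n) :=
  {b | b.2 ∈ detectSet δ L (scale p T b.1) v}

lemma measurableSet_blockKept (p T δ L : ℝ) (x : Fin k × Fin n) :
    MeasurableSet (blockKept p T δ L x) := by
  have hs : Measurable fun b : Block k n => scale p T b.1 :=
    (measurable_scale p T).comp measurable_fst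
  have hc : Measurable fun b : Block k n => ((b.2 x : unitInterval) : ℝ) := by fun_prop
  exact (measurableSet_le (hs.const_mul δ) measurable_const).inter
    (measurableSet_le (hc.mul hs) measurable_const)

lemma measurableSet_blockDetect (p T δ L : ℝ) (v : Fin k → ℕ) :
    MeasurableSet (blockDetect p T δ L v : Set (Block k n)) := by
  classical
  have hs : Measurable fun b : Block k n => scale p T b.1 :=
    (measurable_scale p T).comp measurable_fst
  have hh : (fun b : Block k n => (hits (keptSet δ L (scale p T b.1) v) b.2 : ℝ)) =
      fun b => ∑ x : Fin k × Fin n,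
        if x.2 < v x.1 ∧ b ∈ blockKept p T δ L x then (1 : ℝ) else 0 := by
    ext b
    unfold hits
    rw [Finset.card_filter]
    push_cast
    exact Finset.sum_congr rfl fun x _ => if_congr Iff.rfl rfl rfl
  refine measurableSet_le ((measurable_const.min hs).const_mul _) ?_
  rw [hh]
  refine Finset.measurable_sum _ fun x _ => ?_
  exact Measurable.ite ((MeasurableSet.const _).inter (measurableSet_blockKept p T δ L x))
    measurable_const measurable_const

/-- Scales not clearly above the count contribute at most the length `x0` of their range of `u`,
which is `f ^ p / T ^ p` up to a factor `1 + O(p * δ)`. The larger scales give the tail integral of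
the false-detection bound, which is `δ * f ^ p / T ^ p`. The whole error is thus relative to `f ^
p`. -/
lemma blockMeasure_detect_le {p T δ L : ℝ} (hp : 1 < p) (hT : 0 < T) (hδ : 0 < δ)
    (hδ' : δ ≤ 1 / 8) (hδp : 8 * p * δ ≤ 1) (hL : L = δ⁻¹ ^ 4) (v : Fin k → ℕ) :
    (blockMeasure k n).real (blockDetect p T δ L v) ≤
      (((∑ i, v i : ℕ) : ℝ) ^ p / T ^ p) * (1 + 20 * p * δ) := by
  have hp0 : 0 < p := by linarith
  set f : ℝ := ((∑ i, v i : ℕ) : ℝ) with hf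
  have hf0 : 0 ≤ f := Nat.cast_nonneg _
  set b := 1 - 2 * δ with hb
  have hb0 : 0 < b := by linarith
  set φ := f ^ p / T ^ p with hφ
  have hTp : 0 < T ^ p := by positivity
  have hφ0 : 0 ≤ φ := by positivity
  have hbp : 0 < b ^ p := by positivity
  -- The value of `u` at which `b ^ 2 * scale p T u = f`.
  set x0 := φ / (b ^ p) ^ 2 with hx0
  have hx00 : 0 ≤ x0 := by positivity
  have hlt : ∀ u, x0 < u → f < b ^ 2 * scale p T u := fun u hu => by
    have hu0 : 0 < u := hx00.trans_lt hu
    have hs := scale_pos (p := p) hT hu0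
    rw [← Real.rpow_lt_rpow_iff hf0 (by positivity) hp0, Real.mul_rpow (by positivity) hs.le,
      scale_rpow hp0 hT hu0, ← Real.rpow_natCast b 2, ← Real.rpow_mul hb0.le, mul_comm _ p,
      Real.rpow_mul hb0.le, Real.rpow_natCast]
    rw [hx0, div_lt_iff₀ (by positivity), hφ, div_lt_iff₀ hTp] at hu
    linarith
  have hbound : ∀ u, x0 < u → (coinMeasure k n).real (detectSet δ L (scale p T u) v) ≤
      δ * (φ / b ^ p) ^ 2 * u ^ (-2 : ℝ) := fun u hu => by
    have hu0 : 0 < u := hx00.trans_lt hu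
    have hs := scale_pos (p := p) hT hu0
    refine (measureReal_detectSet_le hδ hδ' hδp hL hs (hlt u hu)).trans (le_of_eq ?_)
    rw [← hf, ← hb, mul_comm 2 p, Real.rpow_mul (by positivity), Real.div_rpow hf0 (by positivity),
      Real.mul_rpow hb0.le hs.le, scale_rpow hp0 hT hu0, Real.rpow_neg hu0.le,
      show (2 : ℝ) = (2 : ℕ) by norm_num, Real.rpow_natCast, Real.rpow_natCast, hφ]
    field_simp
  rcases hφ0.eq_or_lt with h0 | hφpos
  · have hx : x0 = 0 := by rw [hx0, ← h0, zero_div]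
    refine (blockMeasure_real_le (measurableSet_blockDetect p T δ L v) (g := fun _ => 0)
      (integrableOn_zero) (fun _ _ => le_rfl) fun u hu => ?_).trans (by simp [← h0])
    refine (hbound u (by rwa [hx])).trans ?_
    rw [← h0]; simp
  have hx0pos : 0 < x0 := by positivity
  set g1 : ℝ → ℝ := (Set.Ioc 0 x0).indicator fun _ => 1 with hg1
  set g2 : ℝ → ℝ := (Set.Ioi x0).indicator fun u => δ * (φ / b ^ p) ^ 2 * u ^ (-2 : ℝ) with hg2
  have hi1 : IntegrableOn g1 (Set.Ioi 0) := by
    refine Integrable.integrableOn ?_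
    rw [hg1, integrable_indicator_iff measurableSet_Ioc]
    simp [integrableOn_const_iff]
  have hi2 : IntegrableOn g2 (Set.Ioi 0) := by
    refine Integrable.integrableOn ?_
    rw [hg2, integrable_indicator_iff measurableSet_Ioi]
    exact (integrableOn_Ioi_rpow_of_lt (by norm_num) hx0pos).const_mul _
  have h1 : ∫ u in Set.Ioi 0, g1 u = x0 := by
    rw [hg1, setIntegral_indicator measurableSet_Ioc,
      Set.inter_eq_self_of_subset_right Set.Ioc_subset_Ioi_self]
    simp [hx00]
  have h2 : ∫ u in Set.Ioi 0, g2 u = δ * φ := by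
    rw [hg2, setIntegral_indicator measurableSet_Ioi,
      Set.inter_eq_self_of_subset_right (Set.Ioi_subset_Ioi hx00), integral_const_mul,
      integral_Ioi_rpow_of_lt (by norm_num) hx0pos]
    rw [show (-2 : ℝ) + 1 = -1 by norm_num, Real.rpow_neg hx00, Real.rpow_one, hx0]
    field_simp
  have hmain := blockMeasure_real_le (measurableSet_blockDetect (k := k) (n := n) p T δ L v)
    (g := fun u => g1 u + g2 u) (hi1.add hi2) ?_ ?_
  · rw [integral_add hi1 hi2, h1, h2] at hmain
    refine hmain.trans ?_
    have hB : 1 - 4 * p * δ ≤ (b ^ p) ^ 2 := by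
      have := one_add_mul_self_le_rpow_one_add (s := -(2 * δ)) (by linarith) (p := 2 * p)
        (by linarith)
      rw [show (1 : ℝ) + -(2 * δ) = b by rw [hb]; ring, mul_comm 2 p, Real.rpow_mul hb0.le,
        show (2 : ℝ) = (2 : ℕ) by norm_num, Real.rpow_natCast] at this
      push_cast at this
      linarith
    have h3 : x0 ≤ φ * (1 + 8 * p * δ) := by
      rw [hx0, div_le_iff₀ (by positivity), mul_assoc]
      refine le_mul_of_one_le_right hφ0 ?_
      have : (1 + 8 * p * δ) * (1 - 4 * p * δ) ≤ (1 + 8 * p * δ) * (b ^ p) ^ 2 :=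
        mul_le_mul_of_nonneg_left hB (by positivity)
      nlinarith [mul_pos hp0 hδ]
    have h4 : δ ≤ p * δ := le_mul_of_one_le_left hδ.le hp.le
    nlinarith
  · intro u hu
    refine add_nonneg (Set.indicator_nonneg (fun _ _ => zero_le_one) _)
      (Set.indicator_apply_nonneg fun _ => by positivity)
  · intro u hu
    change (coinMeasure k n).real (detectSet δ L (scale p T u) v) ≤ _
    rcases le_or_gt u x0 with h | h
    · rw [hg1, hg2, Set.indicator_of_mem (show u ∈ Set.Ioc 0 x0 from ⟨hu, h⟩),
        Set.indicator_of_notMem (show u ∉ Set.Ioi x0 from not_lt.2 h), add_zero]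
      exact measureReal_le_one
    · rw [hg1, hg2, Set.indicator_of_notMem (show u ∉ Set.Ioc 0 x0 from fun h' => not_lt.2 h'.2 h),
        Set.indicator_of_mem (show u ∈ Set.Ioi x0 from h), zero_add]
      exact hbound u h

/-- For `u ≤ min 1 (f ^ p / T ^ p)` the scale is at most the count, and detection then fails with
probability at most `δ`. -/
lemma le_blockMeasure_detect {p T δ L : ℝ} (hk : 0 < k) (hp : 1 < p) (hT : 0 < T) (hδ : 0 < δ)
    (hδ' : δ ≤ 1 / 8) (hL : L = δ⁻¹ ^ 4) {v : Fin k → ℕ} (hv : ∀ i, v i ≤ n) :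
    (1 - δ) * min 1 (((∑ i, v i : ℕ) : ℝ) ^ p / T ^ p) ≤
      (blockMeasure k n).real (blockDetect p T δ L v) := by
  have hp0 : 0 < p := by linarith
  set f : ℝ := ((∑ i, v i : ℕ) : ℝ) with hf
  have hf0 : 0 ≤ f := Nat.cast_nonneg _
  have hTp : 0 < T ^ p := by positivity
  set m := min 1 (f ^ p / T ^ p) with hm
  have hm0 : 0 ≤ m := le_min zero_le_one (by positivity)
  have hm1 : m ≤ 1 := min_le_left _ _
  have hD := measurableSet_blockDetect (k := k) (n := n) p T δ L v
  rw [blockMeasure_real hD]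
  have hsub : Set.Ioc 0 m ⊆ Set.Ioc (0 : ℝ) 1 := Set.Ioc_subset_Ioc_right hm1
  have hint := integrableOn_coinMeasure_real hD
  calc (1 - δ) * m = ∫ u in Set.Ioc 0 m, (1 - δ) := by
        simp [hm0, mul_comm]
    _ ≤ ∫ u in Set.Ioc 0 m, (coinMeasure k n).real (Prod.mk u ⁻¹' blockDetect p T δ L v) := by
        refine setIntegral_mono_on (by simp [integrableOn_const_iff]) (hint.mono_set hsub)
          measurableSet_Ioc fun u hu => ?_
        have hs := scale_pos (p := p) hT hu.1
        have hle : scale p T u ≤ f := by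
          rw [← Real.rpow_le_rpow_iff hs.le hf0 hp0, scale_rpow hp0 hT hu.1]
          have := hu.2.trans (min_le_right _ _)
          rw [le_div_iff₀ hTp] at this
          linarith
        have h1 := measureReal_compl_detectSet_le hk hδ hδ' hL hs hv hle
        have h2 : MeasurableSet (detectSet δ L (scale p T u) v : Set (Fin k × Fin n → unitInterval)) :=
          measurable_prodMk_left hD
        rw [probReal_compl_eq_one_sub h2] at h1
        change _ ≤ (coinMeasure k n).real (detectSet δ L (scale p T u) v)
        linarith
    _ ≤ _ := setIntegral_mono_set hint (ae_of_all _ fun u => measureReal_nonneg)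
        hsub.eventuallyLE

/-- Lateness confines `u` to `(0, z ^ p]`, where the coin succeeds with probability at most `L / T *
u ^ (-(1 / p))`. This singularity is integrable exactly because `p > 1`; the integral yields the
factor `p / (p - 1)` and the power `z ^ (p - 1)`, the source of `k ^ (p - 1)`. -/
lemma blockMeasure_kept_le {p T δ L : ℝ} (hp : 1 < p) (hT : 0 < T) (hδ : 0 < δ)
    (hL : 0 < L) (x : Fin k × Fin n) :
    (blockMeasure k n).real (blockKept p T δ L x) ≤
      L / T * (p / (p - 1)) * (k * ((x.2 : ℕ) + 1) / (δ * T)) ^ (p - 1) := by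
  have hp0 : 0 < p := by linarith
  have hp1 : 0 < p - 1 := by linarith
  set z : ℝ := k * ((x.2 : ℕ) + 1) / (δ * T) with hz
  have hz0 : 0 ≤ z := by positivity
  have hr : -1 < -(1 / p) := by
    rw [neg_lt_neg_iff, div_lt_one hp0]; exact hp
  set g : ℝ → ℝ := (Set.Ioc 0 (z ^ p)).indicator fun u => L / T * u ^ (-(1 / p)) with hg
  have hzp : 0 ≤ z ^ p := by positivity
  have hi : IntegrableOn (fun u : ℝ => L / T * u ^ (-(1 / p))) (Set.Ioc 0 (z ^ p)) := by
    have := (intervalIntegral.intervalIntegrable_rpow' hr (a := 0) (b := z ^ p))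
    exact ((intervalIntegrable_iff_integrableOn_Ioc_of_le hzp).1 this).const_mul _
  refine (blockMeasure_real_le (measurableSet_blockKept p T δ L x) (g := g) ?_ ?_ ?_).trans ?_
  · refine Integrable.integrableOn ?_
    rwa [hg, integrable_indicator_iff measurableSet_Ioc]
  · intro u hu
    exact Set.indicator_apply_nonneg fun _ => by positivity
  · intro u hu
    have hs := scale_pos (p := p) hT hu
    have hpre : Prod.mk u ⁻¹' blockKept p T δ L x =
        Function.eval x ⁻¹' {c : unitInterval | Kept k δ L (scale p T u) x.2 c} := rfl
    rw [hpre, (measurePreserving_eval (fun _ : Fin k × Fin n => (volume : Measure unitInterval))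
      x).measureReal_preimage (measurableSet_kept δ L _ _).nullMeasurableSet]
    by_cases h : δ * scale p T u ≤ k * ((x.2 : ℕ) + 1)
    · have hmem : u ∈ Set.Ioc 0 (z ^ p) := by
        refine ⟨hu, ?_⟩
        have h1 : u ^ (1 / p) ≤ z := by
          rw [hz, le_div_iff₀ (by positivity)]
          unfold scale at h
          linarith
        have h2 := Real.rpow_le_rpow (by positivity) h1 hp0.le
        rwa [← Real.rpow_mul hu.le, one_div, inv_mul_cancel₀ hp0.ne', Real.rpow_one] at h2
      rw [hg, Set.indicator_of_mem hmem]
      calc _ ≤ (volume : Measure unitInterval).real {c | (c : ℝ) * scale p T u ≤ L} :=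
            measureReal_mono fun c hc => hc.2
        _ ≤ L / scale p T u := by
            rw [volume_real_coin hs hL]; exact min_le_right _ _
        _ = _ := by
            rw [scale, Real.rpow_neg hu.le]; field_simp
    · have : {c : unitInterval | Kept k δ L (scale p T u) x.2 c} = ∅ := by
        ext c
        simp only [Set.mem_empty_iff_false, iff_false]
        exact fun h' => h h'.1
      rw [this, measureReal_empty]
      exact Set.indicator_apply_nonneg fun _ => by positivity
  · rw [hg, setIntegral_indicator measurableSet_Ioc,
      Set.inter_eq_self_of_subset_right Set.Ioc_subset_Ioi_self, integral_const_mul,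
      ← intervalIntegral.integral_of_le hzp, integral_rpow (Or.inl hr)]
    have h1 : -(1 / p) + 1 = (p - 1) / p := by field_simp; ring
    rw [h1, Real.zero_rpow (by positivity), sub_zero, ← Real.rpow_mul hz0,
      mul_div_cancel₀ _ hp0.ne']
    refine le_of_eq ?_
    field_simp

end Randomness

/-! ### Growth of `F_p` along a stream. -/

section Streams

variable {k m : ℕ} (σ : ℕ → Fin k × Fin m)

lemma vec_zero (i : Fin k) (j : Fin m) : vec σ 0 i j = 0 := by simp [vec]

lemma vec_succ (t : ℕ) (i : Fin k) (j : Fin m) :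
    vec σ (t + 1) i j = vec σ t i j + if σ t = (i, j) then 1 else 0 := by
  unfold vec
  rw [Finset.range_add_one, Finset.filter_insert]
  split_ifs with h
  · rw [Finset.card_insert_of_notMem (by simp)]
  · rfl

lemma vec_mono (i : Fin k) (j : Fin m) : Monotone fun t => vec σ t i j :=
  monotone_nat_of_le_succ fun t => by simp only [vec_succ]; omega

lemma vec_le (t : ℕ) (i : Fin k) (j : Fin m) : vec σ t i j ≤ t :=
  (Finset.card_filter_le _ _).trans (Finset.card_range t).le

lemma sum_vec_succ (t : ℕ) (j : Fin m) :
    ∑ i, vec σ (t + 1) i j = ∑ i, vec σ t i j + if (σ t).2 = j then 1 else 0 := by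
  simp_rw [vec_succ, Finset.sum_add_distrib, Prod.ext_iff]
  congr 1
  split_ifs with h <;> simp [h]

lemma Fp_zero {p : ℝ} (hp : p ≠ 0) : Fp p σ 0 = 0 := by
  simp [Fp, vec_zero, hp]

lemma Fp_mono {p : ℝ} (hp : 0 ≤ p) : Monotone (Fp p σ) := fun _ _ h =>
  Finset.sum_le_sum fun j _ => Real.rpow_le_rpow (Nat.cast_nonneg _)
    (Nat.cast_le.2 (Finset.sum_le_sum fun i _ => vec_mono σ i j h)) hp

lemma natCast_add_one_rpow_le {p : ℝ} (hp : 0 < p) (f : ℕ) :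
    ((f : ℝ) + 1) ^ p ≤ 2 ^ p * (f : ℝ) ^ p + 1 := by
  rcases Nat.eq_zero_or_pos f with rfl | hf
  · simp [hp.ne']
  · have h1 : (1 : ℝ) ≤ f := by exact_mod_cast hf
    rw [← Real.mul_rpow zero_le_two (by positivity)]
    have := Real.rpow_le_rpow (by positivity) (show (f : ℝ) + 1 ≤ 2 * f by linarith) hp.le
    linarith

/-- A single update cannot overshoot much: it multiplies a positive count by at most `2`, and turns
a zero count into `1`. This bounds `F_p` at the moment when the threshold is crossed. -/
lemma Fp_succ_le {p : ℝ} (hp : 0 < p) (t : ℕ) : Fp p σ (t + 1) ≤ 2 ^ p * Fp p σ t + 1 := by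
  have h : ∀ j ∈ Finset.univ, ((∑ i : Fin k, vec σ (t + 1) i j : ℕ) : ℝ) ^ p ≤
      2 ^ p * ((∑ i : Fin k, vec σ t i j : ℕ) : ℝ) ^ p + if (σ t).2 = j then 1 else 0 := by
    intro j _
    rw [sum_vec_succ]
    split_ifs with h
    · exact_mod_cast natCast_add_one_rpow_le hp (∑ i : Fin k, vec σ t i j)
    · rw [add_zero, add_zero]
      exact le_mul_of_one_le_left (by positivity) (Real.one_le_rpow one_le_two hp.le)
  refine (Finset.sum_le_sum h).trans (le_of_eq ?_)
  rw [Finset.sum_add_distrib, ← Finset.mul_sum]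
  simp [Fp]

lemma count_localStream (t : ℕ) (i : Fin k) (j : Fin m) :
    (localStream σ t i).count j = vec σ t i j := by
  induction t with
  | zero => simp [localStream, vec_zero]
  | succ t ih =>
    rw [vec_succ, ← ih]
    simp only [localStream, List.range_succ, List.map_append, List.filter_append, List.count_append,
      List.map_cons, List.map_nil]
    congr 1
    by_cases h : (σ t).1 = i <;> by_cases h' : (σ t).2 = j <;> simp [h, h', Prod.ext_iff]

lemma localStream_succ (t : ℕ) :
    localStream σ (t + 1) (σ t).1 = localStream σ t (σ t).1 ++ [(σ t).2] := by
  simp [localStream, List.range_succ]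

/-- Summing over the updates is summing over the local indices of all increments. -/
lemma sum_updates (g : Fin k → Fin m → ℕ → ℕ) (t : ℕ) :
    ∑ s ∈ Finset.range t, g (σ s).1 (σ s).2 (vec σ s (σ s).1 (σ s).2) =
      ∑ i, ∑ j, ∑ l ∈ Finset.range (vec σ t i j), g i j l := by
  induction t with
  | zero => simp [vec_zero]
  | succ t ih =>
    rw [Finset.sum_range_succ, ih]
    have : ∀ i j, ∑ l ∈ Finset.range (vec σ (t + 1) i j), g i j l =
        ∑ l ∈ Finset.range (vec σ t i j), g i j l +
          if (σ t).1 = i then (if (σ t).2 = j then g i j (vec σ t i j) else 0) else 0 := by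
      intro i j
      rw [vec_succ]
      simp only [Prod.ext_iff]
      by_cases h : (σ t).1 = i <;> by_cases h' : (σ t).2 = j <;>
        simp [h, h', Finset.sum_range_succ]
    simp_rw [this, Finset.sum_add_distrib]
    congr 1
    simp

/-- The last time at which `F_p` is below a positive bound. -/
lemma exists_last_Fp_lt {p b : ℝ} (hp : p ≠ 0) (hb : 0 < b) (n : ℕ) :
    ∃ t₀ ≤ n, Fp p σ t₀ < b ∧ ∀ t ≤ n, Fp p σ t < b → t ≤ t₀ := by
  classical
  refine ⟨Nat.findGreatest (fun t => Fp p σ t < b) n, Nat.findGreatest_le n, ?_,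
    fun t ht h => Nat.le_findGreatest ht h⟩
  exact Nat.findGreatest_spec (P := fun t => Fp p σ t < b) (Nat.zero_le n)
    (by rwa [Fp_zero σ hp])

/-- The first time at which `F_p` exceeds `τ`, or the end of the stream. -/
lemma exists_first_lt_Fp {p τ : ℝ} (hp : 0 < p) (hτ : 1 ≤ τ) (n : ℕ) :
    ∃ t₁ ≤ n, (∀ t ≤ n, τ < Fp p σ t → t₁ ≤ t ∧ τ < Fp p σ t₁) ∧ (t₁ < n → τ < Fp p σ t₁) ∧
      Fp p σ t₁ ≤ (2 ^ p + 1) * τ := by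
  classical
  have key : ∀ t, (∀ s < t, Fp p σ s ≤ τ) → Fp p σ t ≤ (2 ^ p + 1) * τ := by
    intro t ht
    rcases t with _ | t
    · rw [Fp_zero σ hp.ne']; positivity
    · refine (Fp_succ_le σ hp t).trans ?_
      have := mul_le_mul_of_nonneg_left (ht t (Nat.lt_succ_self t))
        (show (0 : ℝ) ≤ 2 ^ p by positivity)
      linarith
  by_cases h : ∃ t, t ≤ n ∧ τ < Fp p σ t
  · refine ⟨Nat.find h, (Nat.find_spec h).1, fun t ht hlt => ⟨Nat.find_min' h ⟨ht, hlt⟩,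
      (Nat.find_spec h).2⟩, fun _ => (Nat.find_spec h).2, key _ fun s hs => ?_⟩
    have := Nat.find_min h hs
    by_contra hcon
    exact this ⟨hs.le.trans (Nat.find_spec h).1, not_le.1 hcon⟩
  · push Not at h
    exact ⟨n, le_rfl, fun t ht hlt => absurd hlt (not_lt.2 (h t ht)), fun h' => absurd h' (lt_irrefl n),
      key _ fun s hs => h s hs.le⟩

end Streams

/-! ### The protocol over a universe with short names, and its deterministic analysis. -/

section Protocol

variable {k n R M : ℕ}

/-- The increment of site `i` with local index `l` is reported in the copy with randomness `b`. -/
def Reported (p T δ L : ℝ) (b : Block k n) (i : Fin k) (l : ℕ) : Prop :=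
  ∃ h : l < n, b ∈ blockKept p T δ L (i, ⟨l, h⟩)

open Classical in
/-- The copies in which an increment of coordinate `j` is reported. -/
noncomputable def reportBits (p T δ L : ℝ) (ω : Fin R × Fin M → Block k n) (i : Fin k) (j : Fin M)
    (l : ℕ) (r : Fin R) : Bool :=
  decide (Reported p T δ L (ω (r, j)) i l)

open Classical in
/-- The message announcing that coordinate `j` is incremented, with the copies concerned. -/
noncomputable def announce (enc : Fin M → (Fin R → Bool) → List Bool) (j : Fin M)
    (g : Fin R → Bool) : List Bool :=
  if ∃ r, g r = true then enc j g else []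

/-- The message of a site with local stream `h`. -/
noncomputable def sendMessage (p T δ L : ℝ) (enc : Fin M → (Fin R → Bool) → List Bool)
    (ω : Fin R × Fin M → Block k n) (i : Fin k) (h : List (Fin M)) : List Bool :=
  match h.getLast? with
  | none => []
  | some j => announce enc j (reportBits p T δ L ω i j (h.count j - 1))

open Classical in
/-- The number of reported increments of coordinate `x.2` in copy `x.1`. -/
noncomputable def tally (enc : Fin M → (Fin R → Bool) → List Bool)
    (S : List (Fin k × List Bool)) (x : Fin R × Fin M) : ℕ :=
  S.countP fun a => decide (∃ g, g x.1 = true ∧ a.2 = enc x.2 g)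

/-- The randomness with which a coordinate is detected from a tally. -/
def tallySet (p T δ L : ℝ) (c : ℕ) : Set (Block k n) :=
  {b | (1 - 2 * δ) * min L (scale p T b.1) ≤ c}

lemma measurableSet_tallySet (p T δ L : ℝ) (c : ℕ) :
    MeasurableSet (tallySet p T δ L c : Set (Block k n)) :=
  measurableSet_le ((measurable_const.min ((measurable_scale p T).comp measurable_fst)).const_mul _)
    measurable_const

lemma measurable_reportBits (p T δ L : ℝ) (i : Fin k) (j : Fin M) (l : ℕ) :
    Measurable fun ω : Fin R × Fin M → Block k n => reportBits p T δ L ω i j l := by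
  classical
  refine measurable_pi_lambda _ fun r => ?_
  refine measurable_to_bool ?_
  by_cases h : l < n
  · have : (fun ω : Fin R × Fin M → Block k n => reportBits p T δ L ω i j l r) ⁻¹' {true} =
        Function.eval (r, j) ⁻¹' blockKept p T δ L (i, ⟨l, h⟩) := by
      ext ω; simp [reportBits, Reported, h]
    rw [this]
    exact measurable_pi_apply _ (measurableSet_blockKept p T δ L _)
  · have : (fun ω : Fin R × Fin M → Block k n => reportBits p T δ L ω i j l r) ⁻¹' {true} = ∅ := by
      ext ω; simp [reportBits, Reported, h]
    rw [this]; exact MeasurableSet.empty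

lemma measurableSet_sendMessage (p T δ L : ℝ) (enc : Fin M → (Fin R → Bool) → List Bool)
    (i : Fin k) (h : List (Fin M)) (w : List Bool) :
    MeasurableSet {ω : Fin R × Fin M → Block k n | sendMessage p T δ L enc ω i h = w} := by
  unfold sendMessage
  rcases h.getLast? with _ | j
  · exact MeasurableSet.const ([] = w)
  · exact measurable_reportBits p T δ L i j (h.count j - 1)
      (MeasurableSet.of_discrete (s := {g | announce enc j g = w}))

open Classical in
/-- The protocol: a coordinate is detected in a copy if sufficiently many reported increments have
arrived, and the coordinator outputs `1` once `θ` detections have been made. -/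
noncomputable def protocol (p T δ L θ : ℝ) (k n R M : ℕ)
    (enc : Fin M → (Fin R → Bool) → List Bool) : OneWayProtocol k M where
  Ω := Fin R × Fin M → Block k n
  P := Measure.pi fun _ => blockMeasure k n
  send := sendMessage p T δ L enc
  decide1 ω S := decide (θ ≤ hits (fun x => tallySet p T δ L (tally enc S x)) ω)
  measurableSet_send := measurableSet_sendMessage p T δ L enc
  measurableSet_decide1 S := by
    simp only [decide_eq_true_eq]
    exact measurableSet_le measurable_const
      (measurable_from_top.comp (measurable_hits fun x => measurableSet_tallySet p T δ L _))

variable {p T δ L θ : ℝ} {enc : Fin M → (Fin R → Bool) → List Bool}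
  (ω : (protocol p T δ L θ k n R M enc).Ω) (σ : ℕ → Fin k × Fin M)

lemma protocol_message (t : ℕ) :
    (protocol p T δ L θ k n R M enc).message ω σ t =
      announce enc (σ t).2
        (reportBits p T δ L ω (σ t).1 (σ t).2 (vec σ t (σ t).1 (σ t).2)) := by
  change sendMessage p T δ L enc ω (σ t).1 (localStream σ (t + 1) (σ t).1) = _
  rw [localStream_succ]
  unfold sendMessage
  rw [List.getLast?_concat]
  simp only [List.count_append, count_localStream, List.count_singleton_self, Nat.add_sub_cancel]

lemma received_succ {m : ℕ} (Q : OneWayProtocol k m) (ω : Q.Ω) (σ : ℕ → Fin k × Fin m) (t : ℕ) :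
    Q.received ω σ (t + 1) = Q.received ω σ t ++
      if Q.message ω σ t = [] then [] else [((σ t).1, Q.message ω σ t)] := by
  unfold OneWayProtocol.received
  rw [List.range_succ, List.map_append, List.filter_append]
  congr 1
  split_ifs with h <;> simp [h]

-- Injectivity of the code lets the coordinator recover the coordinate and the copies from each
-- message. Codewords are nonempty, so no report is lost as silence.
open Classical in
lemma tally_received (hinj : ∀ j g j' g', enc j g = enc j' g' → j = j' ∧ g = g')
    (hne : ∀ j g, enc j g ≠ []) (t : ℕ) (x : Fin R × Fin M) :
    tally enc ((protocol p T δ L θ k n R M enc).received ω σ t) x =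
      ∑ s ∈ Finset.range t, if (σ s).2 = x.2 ∧
        Reported p T δ L (ω (x.1, (σ s).2)) (σ s).1 (vec σ s (σ s).1 (σ s).2) then 1 else 0 := by
  induction t with
  | zero => simp [OneWayProtocol.received, tally]
  | succ t ih =>
    rw [received_succ, Finset.sum_range_succ, ← ih]
    unfold tally
    rw [List.countP_append]
    congr 1
    rw [protocol_message]
    set g := reportBits p T δ L ω (σ t).1 (σ t).2 (vec σ t (σ t).1 (σ t).2) with hg
    have hgx : Reported p T δ L (ω (x.1, (σ t).2)) (σ t).1 (vec σ t (σ t).1 (σ t).2) ↔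
        g x.1 = true := by simp [hg, reportBits]
    rw [hgx]
    by_cases hr : ∃ r, g r = true
    · have hex : (∃ g', g' x.1 = true ∧ enc (σ t).2 g = enc x.2 g') ↔
          (σ t).2 = x.2 ∧ g x.1 = true := by
        constructor
        · rintro ⟨g', h1, h2⟩
          obtain ⟨h3, rfl⟩ := hinj _ _ _ _ h2
          exact ⟨h3, h1⟩
        · rintro ⟨h1, h2⟩
          exact ⟨g, h2, by rw [h1]⟩
      simp only [announce, hr, if_true, hne, if_false, List.countP_singleton, hex,
        decide_eq_true_eq]
      by_cases h1 : (σ t).2 = x.2 <;> by_cases h2 : g x.1 = true <;> simp [h1, h2]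
    · have : g x.1 ≠ true := fun h => hr ⟨_, h⟩
      simp [announce, hr, this]

/-- The coin of an increment is indexed by its site and local index, so the interleaving of the
sites is irrelevant. The restriction `t ≤ n` is needed because there are only `n` coins per site. -/
lemma tally_received_eq_hits (hinj : ∀ j g j' g', enc j g = enc j' g' → j = j' ∧ g = g')
    (hne : ∀ j g, enc j g ≠ []) {t : ℕ} (ht : t ≤ n) (x : Fin R × Fin M) :
    tally enc ((protocol p T δ L θ k n R M enc).received ω σ t) x =
      hits (keptSet δ L (scale p T (ω x).1) fun i => vec σ t i x.2) (ω x).2 := by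
  classical
  rw [tally_received ω σ hinj hne, sum_updates σ (fun i j l => if j = x.2 ∧
        Reported p T δ L (ω (x.1, j)) i l then 1 else 0)]
  unfold hits
  rw [Finset.card_filter, Fintype.sum_prod_type]
  refine Finset.sum_congr rfl fun i _ => ?_
  rw [Finset.sum_eq_single x.2 (fun j _ hj => by simp [hj]) (by simp)]
  have hv : vec σ t i x.2 ≤ n := (vec_le σ t i x.2).trans ht
  have h1 : ∀ l : Fin n, (if (ω x).2 (i, l) ∈ keptSet δ L (scale p T (ω x).1)
      (fun i => vec σ t i x.2) (i, l) then 1 else 0) =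
      (fun l : ℕ => if l < vec σ t i x.2 ∧ Reported p T δ L (ω x) i l then 1 else 0) l := by
    intro l
    refine if_congr ?_ rfl rfl
    exact and_congr Iff.rfl ⟨fun h => ⟨l.2, h⟩, fun ⟨_, h⟩ => h⟩
  rw [Finset.sum_congr rfl fun l _ => h1 l, ← Finset.sum_range (fun l : ℕ =>
    if l < vec σ t i x.2 ∧ Reported p T δ L (ω x) i l then 1 else 0)]
  symm
  refine (Finset.sum_subset (Finset.range_subset_range.2 hv) fun l _ hl => ?_).symm.trans ?_
  · rw [Finset.mem_range] at hl; simp [hl]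
  · refine Finset.sum_congr rfl fun l hl => ?_
    rw [Finset.mem_range] at hl; simp [hl]

/-- The number of detections after the first `t` updates. -/
noncomputable def detections (p T δ L : ℝ) (σ : ℕ → Fin k × Fin M) (t : ℕ)
    (ω : Fin R × Fin M → Block k n) : ℕ :=
  hits (fun x => blockDetect p T δ L fun i => vec σ t i x.2) ω

lemma detections_mono (ω : Fin R × Fin M → Block k n) :
    Monotone fun t => detections p T δ L σ t ω := by
  intro s t h
  refine hits_mono fun x hx => ?_
  have hx' : (1 - 2 * δ) * min L (scale p T (ω x).1) ≤
      hits (keptSet δ L (scale p T (ω x).1) fun i => vec σ s i x.2) (ω x).2 := hx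
  exact hx'.trans (Nat.cast_le.2 (hits_mono fun y hy =>
    ⟨hy.1.trans_le (vec_mono σ _ _ h), hy.2⟩))

/-- Detections never disappear, so keeping the output at `1` after an earlier alarm is the same as
testing at the current time. -/
lemma protocol_output (hinj : ∀ j g j' g', enc j g = enc j' g' → j = j' ∧ g = g')
    (hne : ∀ j g, enc j g ≠ []) {t : ℕ} (ht : t ≤ n) :
    (protocol p T δ L θ k n R M enc).output ω σ t = true ↔ θ ≤ detections p T δ L σ t ω := by
  have h1 : ∀ s ≤ n, (protocol p T δ L θ k n R M enc).decide1 ω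
      ((protocol p T δ L θ k n R M enc).received ω σ s) = true ↔
      θ ≤ detections p T δ L σ s ω := by
    intro s hs
    simp only [protocol, decide_eq_true_eq]
    have heq : hits (fun x => (tallySet p T δ L (tally enc
        ((protocol p T δ L θ k n R M enc).received ω σ s) x) : Set (Block k n))) ω =
        detections p T δ L σ s ω :=
      hits_congr fun x => by rw [tally_received_eq_hits ω σ hinj hne hs]; exact Iff.rfl
    exact iff_of_eq (congrArg (fun c : ℕ => θ ≤ (c : ℝ)) heq)
  unfold OneWayProtocol.output
  rw [List.any_eq_true]
  constructor
  · rintro ⟨s, hs, h⟩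
    rw [List.mem_range, Nat.lt_succ_iff] at hs
    exact ((h1 s (hs.trans ht)).1 h).trans (Nat.cast_le.2 (detections_mono σ ω hs))
  · exact fun h => ⟨t, by simp, (h1 t ht).2 h⟩

open Classical in
/-- The number of reports, over all copies, that are caused by the first `t` updates. -/
noncomputable def reports (p T δ L : ℝ) (σ : ℕ → Fin k × Fin M) (t : ℕ)
    (ω : Fin R × Fin M → Block k n) : ℕ :=
  ∑ i, ∑ j, ∑ l ∈ Finset.range (vec σ t i j), ∑ r : Fin R,
    if Reported p T δ L (ω (r, j)) i l then 1 else 0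

/-- A nonempty message contains at least one report, so its length is at most `len` times the
reports caused by its update. Messages from index `t₁` on are free because the protocol has
terminated. -/
lemma protocol_communication_le {len : ℕ} (hlen : ∀ j g, (enc j g).length ≤ len) {t₁ : ℕ}
    (hout : ∀ t, t₁ ≤ t → t < n → (protocol p T δ L θ k n R M enc).output ω σ t = true) :
    (protocol p T δ L θ k n R M enc).communication ω σ n ≤ len * reports p T δ L σ t₁ ω := by
  classical
  unfold reports
  rw [← sum_updates σ (fun i j l => ∑ r : Fin R,
    if Reported p T δ L (ω (r, j)) i l then 1 else 0), Finset.mul_sum]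
  unfold OneWayProtocol.communication
  calc _ ≤ ∑ t ∈ Finset.range n, if t < t₁ then
        ((protocol p T δ L θ k n R M enc).message ω σ t).length else 0 := by
        refine Finset.sum_le_sum fun t ht => ?_
        rw [Finset.mem_range] at ht
        by_cases h : t < t₁
        · simp only [h, if_true]; split_ifs <;> omega
        · simp [h, hout t (not_lt.1 h) ht]
    _ ≤ ∑ t ∈ Finset.range t₁, ((protocol p T δ L θ k n R M enc).message ω σ t).length := by
        rw [← Finset.sum_filter]
        refine Finset.sum_le_sum_of_subset fun t ht => ?_
        rw [Finset.mem_filter] at ht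
        exact Finset.mem_range.2 ht.2
    _ ≤ _ := by
        refine Finset.sum_le_sum fun t _ => ?_
        rw [protocol_message]
        unfold announce
        split_ifs with h
        · obtain ⟨r, hr⟩ := h
          have hr' : Reported p T δ L (ω (r, (σ t).2)) (σ t).1 (vec σ t (σ t).1 (σ t).2) := by
            simpa [reportBits] using hr
          refine (hlen _ _).trans (Nat.le_mul_of_pos_right _ ?_)
          refine Finset.sum_pos' (fun _ _ => Nat.zero_le _) ⟨r, Finset.mem_univ _, ?_⟩
          rw [if_pos hr']; exact one_pos
        · simp

end Protocol

/-! ### Concentration of the detections, and the expected number of reports. -/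

section Probability

variable {k n R M : ℕ} {p T δ L : ℝ} (σ : ℕ → Fin k × Fin M)

/-- The distribution of the randomness of all copies of all coordinates. -/
noncomputable abbrev copiesMeasure (k n R M : ℕ) : Measure (Fin R × Fin M → Block k n) :=
  Measure.pi fun _ => blockMeasure k n

/-- With `p * δ = ε / 100` the relative error of the detection probability is `ε / 5`, and `(1 + ε /
5) / (1 + ε) ≤ 1 - 4 * (ε / 10)` for `ε ≤ 1`. The loss `2 * ε / 10` of the decision threshold lies
between this gap and the loss `ε / 10` in the case `F_p > τ`. -/
lemma sum_blockDetect_le (hp : 1 < p) (hT : 0 < T) (hδ : 0 < δ)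
    (hL : L = δ⁻¹ ^ 4) {ε : ℝ} (hε : 0 < ε) (hε1 : ε ≤ 1) (hδε : δ = ε / (100 * p)) {t : ℕ}
    (hF : Fp p σ t < T ^ p / (1 + ε)) :
    ∑ x : Fin R × Fin M, (blockMeasure k n).real (blockDetect p T δ L fun i => vec σ t i x.2) ≤
      (1 - 4 * (ε / 10)) * R := by
  have hp0 : 0 < p := by linarith
  have hpδ : p * δ = ε / 100 := by rw [hδε]; field_simp
  have hTp : 0 < T ^ p := by positivity
  have hδp : δ ≤ p * δ := le_mul_of_one_le_left hδ.le hp.le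
  calc _ ≤ ∑ x : Fin R × Fin M,
        (((∑ i, vec σ t i x.2 : ℕ) : ℝ) ^ p / T ^ p) * (1 + 20 * p * δ) :=
        Finset.sum_le_sum fun x _ => blockMeasure_detect_le hp hT hδ (by linarith)
          (by linarith) hL _
    _ = R * (Fp p σ t / T ^ p * (1 + ε / 5)) := by
        rw [Fintype.sum_prod_type]
        simp only [Finset.sum_const, Finset.card_univ, Fintype.card_fin, nsmul_eq_mul]
        rw [← Finset.sum_mul, ← Finset.sum_div, Fp, mul_assoc 20, hpδ]
        ring
    _ ≤ R * (1 - 4 * (ε / 10)) := by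
        refine mul_le_mul_of_nonneg_left ?_ (Nat.cast_nonneg _)
        have h1 : Fp p σ t / T ^ p ≤ 1 / (1 + ε) := by
          rw [div_le_iff₀ hTp, one_div_mul_eq_div]; exact hF.le
        refine (mul_le_mul_of_nonneg_right h1 (by positivity)).trans ?_
        rw [one_div_mul_eq_div, div_le_iff₀ (by positivity)]
        nlinarith
    _ = _ := by ring

lemma detections_ge_unlikely {e : ℝ} (he0 : 0 < e) (he : e ≤ 1 / 2) {t : ℕ}
    (h : ∑ x : Fin R × Fin M, (blockMeasure k n).real
      (blockDetect p T δ L fun i => vec σ t i x.2) ≤ (1 - 4 * e) * R) :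
    (copiesMeasure k n R M).real {ω | (1 - 2 * e) * R ≤ detections p T δ L σ t ω} ≤
      Real.exp (-(e ^ 2 * R)) :=
  measureReal_le_hits_exp (blockMeasure k n)
    (fun x : Fin R × Fin M => measurableSet_blockDetect p T δ L fun i => vec σ t i x.2) he0 he
    (Nat.cast_nonneg R) h

/-- The truncation in `min 1 (f ^ p / T ^ p)` does no harm: either one coordinate alone reaches `1`,
or nothing is truncated and the sum is `F_p / T ^ p`. -/
lemma le_sum_blockDetect (hk : 0 < k) (hp : 1 < p) (hT : 0 < T) (hδ : 0 < δ)
    (hL : L = δ⁻¹ ^ 4) {ε : ℝ} (hε1 : ε ≤ 1) (hδε : δ ≤ ε / 100) {t : ℕ}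
    (ht : t ≤ n) (hF : T ^ p < Fp p σ t) :
    (1 - ε / 10) * R ≤ ∑ x : Fin R × Fin M,
      (blockMeasure k n).real (blockDetect p T δ L fun i => vec σ t i x.2) := by
  have hTp : 0 < T ^ p := by positivity
  have hsum : 1 ≤ ∑ j, min 1 (((∑ i, vec σ t i j : ℕ) : ℝ) ^ p / T ^ p) := by
    by_cases h : ∃ j, 1 ≤ ((∑ i, vec σ t i j : ℕ) : ℝ) ^ p / T ^ p
    · obtain ⟨j, hj⟩ := h
      refine (min_eq_left hj).ge.trans ?_
      exact Finset.single_le_sum (f := fun j => min 1 (((∑ i, vec σ t i j : ℕ) : ℝ) ^ p / T ^ p))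
        (fun j _ => le_min zero_le_one (by positivity)) (Finset.mem_univ j)
    · push Not at h
      rw [Finset.sum_congr rfl fun j _ => min_eq_right (h j).le, ← Finset.sum_div,
        one_le_div hTp]
      exact hF.le
  calc (1 - ε / 10) * R ≤ R * ((1 - δ) * ∑ j, min 1 (((∑ i, vec σ t i j : ℕ) : ℝ) ^ p / T ^ p)) := by
        rw [mul_comm]
        refine mul_le_mul_of_nonneg_left ?_ (Nat.cast_nonneg _)
        nlinarith
    _ = ∑ x : Fin R × Fin M, (1 - δ) * min 1 (((∑ i, vec σ t i x.2 : ℕ) : ℝ) ^ p / T ^ p) := by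
        rw [Fintype.sum_prod_type]
        simp only [Finset.sum_const, Finset.card_univ, Fintype.card_fin, nsmul_eq_mul]
        rw [← Finset.mul_sum]
    _ ≤ _ := Finset.sum_le_sum fun x _ => le_blockMeasure_detect hk hp hT hδ (by linarith) hL
          fun i => (vec_le σ t i x.2).trans ht

lemma detections_le_unlikely {e : ℝ} (he0 : 0 < e) (he : e ≤ 1 / 2) {t : ℕ}
    (h : (1 - e) * R ≤ ∑ x : Fin R × Fin M, (blockMeasure k n).real
      (blockDetect p T δ L fun i => vec σ t i x.2)) :
    (copiesMeasure k n R M).real {ω | detections p T δ L σ t ω ≤ (1 - 2 * e) * R} ≤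
      Real.exp (-(e ^ 3 * R)) :=
  measureReal_hits_le_exp (blockMeasure k n)
    (fun x : Fin R × Fin M => measurableSet_blockDetect p T δ L fun i => vec σ t i x.2) he0 he
    (Nat.cast_nonneg R) h

/-- Each local position `l + 1` is at most the total count `f`, and there are `f` terms. -/
lemma sum_sum_range_rpow_le (hp : 1 < p) (v : Fin k → ℕ) :
    ∑ i, ∑ l ∈ Finset.range (v i), ((l : ℝ) + 1) ^ (p - 1) ≤ ((∑ i, v i : ℕ) : ℝ) ^ p := by
  set f := ∑ i, v i with hf
  calc _ ≤ ∑ i, ∑ l ∈ Finset.range (v i), (f : ℝ) ^ (p - 1) := by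
        refine Finset.sum_le_sum fun i _ => Finset.sum_le_sum fun l hl => ?_
        refine Real.rpow_le_rpow (by positivity) ?_ (by linarith)
        have h1 : v i ≤ f := Finset.single_le_sum (f := v) (fun _ _ => Nat.zero_le _)
          (Finset.mem_univ i)
        rw [Finset.mem_range] at hl
        exact_mod_cast (show l + 1 ≤ f by omega)
    _ = f * (f : ℝ) ^ (p - 1) := by
        simp only [Finset.sum_const, Finset.card_range, nsmul_eq_mul]
        rw [← Finset.sum_mul, hf]
        push_cast; rfl
    _ = (f : ℝ) ^ p := by
        rcases Nat.eq_zero_or_pos f with h | h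
        · rw [h]; simp [(show p ≠ 0 by linarith)]
        · have h' : (0 : ℝ) < f := by exact_mod_cast h
          rw [← Real.rpow_one_add' h'.le (by linarith)]
          congr 1; ring

lemma measureReal_reported_le (hp : 1 < p) (hT : 0 < T) (hδ : 0 < δ) (hL : 0 < L)
    (x : Fin R × Fin M) (i : Fin k) {l : ℕ} (hl : l < n) :
    (copiesMeasure k n R M).real {ω | Reported p T δ L (ω x) i l} ≤
      L / T * (p / (p - 1)) * (k / (δ * T)) ^ (p - 1) * ((l : ℝ) + 1) ^ (p - 1) := by
  have h : {ω : Fin R × Fin M → Block k n | Reported p T δ L (ω x) i l} =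
      Function.eval x ⁻¹' blockKept p T δ L (i, ⟨l, hl⟩) := by
    ext ω
    exact ⟨fun ⟨_, h⟩ => h, fun h => ⟨hl, h⟩⟩
  rw [h, (measurePreserving_eval (fun _ : Fin R × Fin M => blockMeasure k n)
    x).measureReal_preimage (measurableSet_blockKept p T δ L _).nullMeasurableSet]
  refine (blockMeasure_kept_le hp hT hδ hL _).trans (le_of_eq ?_)
  rw [mul_assoc _ ((k / (δ * T)) ^ (p - 1)), ← Real.mul_rpow (by positivity) (by positivity)]
  congr 2
  field_simp

lemma measurableSet_reported (x : Fin R × Fin M) (i : Fin k) (l : ℕ) :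
    MeasurableSet {ω : Fin R × Fin M → Block k n | Reported p T δ L (ω x) i l} := by
  by_cases hl : l < n
  · have h : {ω : Fin R × Fin M → Block k n | Reported p T δ L (ω x) i l} =
        Function.eval x ⁻¹' blockKept p T δ L (i, ⟨l, hl⟩) := by
      ext ω
      exact ⟨fun ⟨_, h⟩ => h, fun h => ⟨hl, h⟩⟩
    rw [h]
    exact measurable_pi_apply _ (measurableSet_blockKept p T δ L _)
  · have h : {ω : Fin R × Fin M → Block k n | Reported p T δ L (ω x) i l} = ∅ := by
      ext ω
      exact ⟨fun ⟨h, _⟩ => hl h, fun h => h.elim⟩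
    rw [h]
    exact MeasurableSet.empty

lemma reports_eq (t : ℕ) (ω : Fin R × Fin M → Block k n) :
    (reports p T δ L σ t ω : ℝ) = ∑ r : Fin R, ∑ j, ∑ i, ∑ l ∈ Finset.range (vec σ t i j),
      {ω : Fin R × Fin M → Block k n | Reported p T δ L (ω (r, j)) i l}.indicator
        (fun _ => (1 : ℝ)) ω := by
  classical
  unfold reports
  push_cast
  have h : ∀ (r : Fin R) (j : Fin M) (i : Fin k) (l : ℕ),
      {ω : Fin R × Fin M → Block k n | Reported p T δ L (ω (r, j)) i l}.indicator
        (fun _ => (1 : ℝ)) ω = if Reported p T δ L (ω (r, j)) i l then 1 else 0 :=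
    fun _ _ _ _ => rfl
  simp_rw [h]
  rw [Finset.sum_comm' (t' := Finset.univ) (s' := fun _ => Finset.univ) (by simp)]
  rw [Finset.sum_comm' (s := (Finset.univ : Finset (Fin R))) (t' := Finset.univ)
    (s' := fun _ => Finset.univ) (by simp)]
  refine Finset.sum_congr rfl fun j _ => ?_
  rw [Finset.sum_comm' (s := (Finset.univ : Finset (Fin R))) (t' := Finset.univ)
    (s' := fun _ => Finset.univ) (by simp)]
  refine Finset.sum_congr rfl fun i _ => ?_
  rw [Finset.sum_comm]

lemma integrable_reports (t : ℕ) :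
    Integrable (fun ω => (reports p T δ L σ t ω : ℝ)) (copiesMeasure k n R M) := by
  simp_rw [reports_eq]
  refine integrable_finsetSum _ fun r _ => integrable_finsetSum _ fun j _ =>
    integrable_finsetSum _ fun i _ => integrable_finsetSum _ fun l _ => ?_
  exact (integrable_const _).indicator (measurableSet_reported _ _ _)

lemma integral_reports_le (hp : 1 < p) (hT : 0 < T) (hδ : 0 < δ) (hL : 0 < L) {t : ℕ}
    (ht : t ≤ n) :
    ∫ ω, (reports p T δ L σ t ω : ℝ) ∂(copiesMeasure k n R M) ≤
      R * (L / T * (p / (p - 1)) * (k / (δ * T)) ^ (p - 1)) * Fp p σ t := by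
  have hi : ∀ (r : Fin R) (j : Fin M) (i : Fin k) (l : ℕ), Integrable
      ({ω : Fin R × Fin M → Block k n | Reported p T δ L (ω (r, j)) i l}.indicator
        (fun _ => (1 : ℝ))) (copiesMeasure k n R M) := fun r j i l =>
    (integrable_const _).indicator (measurableSet_reported _ _ _)
  have hp1 : 0 < p - 1 := by linarith
  set K := L / T * (p / (p - 1)) * (k / (δ * T)) ^ (p - 1) with hK
  have hK0 : 0 ≤ K := by positivity
  simp_rw [reports_eq]
  calc _ = ∑ r : Fin R, ∑ j, ∑ i, ∑ l ∈ Finset.range (vec σ t i j),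
        (copiesMeasure k n R M).real {ω | Reported p T δ L (ω (r, j)) i l} := by
        rw [integral_finsetSum _ fun r _ => integrable_finsetSum _ fun j _ =>
          integrable_finsetSum _ fun i _ => integrable_finsetSum _ fun l _ => hi r j i l]
        refine Finset.sum_congr rfl fun r _ => ?_
        rw [integral_finsetSum _ fun j _ =>
          integrable_finsetSum _ fun i _ => integrable_finsetSum _ fun l _ => hi r j i l]
        refine Finset.sum_congr rfl fun j _ => ?_
        rw [integral_finsetSum _ fun i _ => integrable_finsetSum _ fun l _ => hi r j i l]
        refine Finset.sum_congr rfl fun i _ => ?_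
        rw [integral_finsetSum _ fun l _ => hi r j i l]
        refine Finset.sum_congr rfl fun l _ => ?_
        rw [integral_indicator_const _ (measurableSet_reported _ _ _)]
        simp
    _ ≤ ∑ r : Fin R, ∑ j, ∑ i, ∑ l ∈ Finset.range (vec σ t i j),
        K * ((l : ℝ) + 1) ^ (p - 1) := by
        refine Finset.sum_le_sum fun r _ => Finset.sum_le_sum fun j _ =>
          Finset.sum_le_sum fun i _ => Finset.sum_le_sum fun l hl => ?_
        exact measureReal_reported_le hp hT hδ hL _ i
          ((Finset.mem_range.1 hl).trans_le ((vec_le σ t i j).trans ht))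
    _ = R * (K * ∑ j, ∑ i, ∑ l ∈ Finset.range (vec σ t i j), ((l : ℝ) + 1) ^ (p - 1)) := by
        simp only [Finset.sum_const, Finset.card_univ, Fintype.card_fin, nsmul_eq_mul,
          ← Finset.mul_sum]
    _ ≤ R * (K * Fp p σ t) := by
        refine mul_le_mul_of_nonneg_left (mul_le_mul_of_nonneg_left ?_ hK0) (Nat.cast_nonneg _)
        exact Finset.sum_le_sum fun j _ => sum_sum_range_rpow_le hp _
    _ = _ := by ring

/-- An upper bound for the expected number of reports. -/
noncomputable def reportBound (p δ L : ℝ) (k R : ℕ) : ℝ :=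
  R * L * (p / (p - 1)) * (δ⁻¹) ^ (p - 1) * (2 ^ p + 1) * (k : ℝ) ^ (p - 1)

/-- Markov's inequality. The factor `1 / T ^ p` of the cost of an increment cancels against `F_p =
O(T ^ p)`, so the bound does not depend on the threshold. -/
lemma reports_ge_unlikely (hk : 0 < k) (hR : 0 < R) (hp : 1 < p) (hT : 0 < T) (hδ : 0 < δ)
    (hL : 0 < L) {t : ℕ} (ht : t ≤ n) (hF : Fp p σ t ≤ (2 ^ p + 1) * T ^ p) :
    (copiesMeasure k n R M).real {ω | 20 * reportBound p δ L k R ≤ reports p T δ L σ t ω} ≤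
      1 / 20 := by
  have hp1 : 0 < p - 1 := by linarith
  have hk' : (0 : ℝ) < k := by exact_mod_cast hk
  have hR' : (0 : ℝ) < R := by exact_mod_cast hR
  have hB : 0 < reportBound p δ L k R := by unfold reportBound; positivity
  have h1 := mul_meas_ge_le_integral_of_nonneg (μ := copiesMeasure k n R M)
    (f := fun ω => (reports p T δ L σ t ω : ℝ)) (ae_of_all _ fun ω => Nat.cast_nonneg _)
    (integrable_reports σ t) (20 * reportBound p δ L k R)
  have h2 := h1.trans (integral_reports_le σ hp hT hδ hL ht)
  have h3 : R * (L / T * (p / (p - 1)) * (k / (δ * T)) ^ (p - 1)) * Fp p σ t ≤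
      reportBound p δ L k R := by
    refine (mul_le_mul_of_nonneg_left hF (by positivity)).trans (le_of_eq ?_)
    have h4 : T ^ p = T * T ^ (p - 1) := by
      rw [← Real.rpow_one_add' hT.le (by linarith)]; congr 1; ring
    rw [Real.div_rpow hk'.le (by positivity), Real.mul_rpow hδ.le hT.le, h4, reportBound,
      Real.inv_rpow hδ.le]
    field_simp
  have h5 := h2.trans h3
  set q := (copiesMeasure k n R M).real {ω | 20 * reportBound p δ L k R ≤ reports p T δ L σ t ω}
  have h6 : reportBound p δ L k R * (20 * q) ≤ reportBound p δ L k R := by linarith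
  have h7 := (mul_le_iff_le_one_right hB).1 h6
  linarith

end Probability

/-! ### Assembling the protocol for thresholds at least `1`. -/

section Existence

/-- The code of a coordinate and a set of copies. -/
lemma exists_code (H R : ℕ) (hR : 0 < R) :
    ∃ enc : Fin (2 ^ H) → (Fin R → Bool) → List Bool,
      (∀ j g j' g', enc j g = enc j' g' → j = j' ∧ g = g') ∧ (∀ j g, enc j g ≠ []) ∧
      ∀ j g, (enc j g).length ≤ H + R := by
  have e : Fin (2 ^ H) ≃ (Fin H → Bool) := Fintype.equivOfCardEq (by simp)
  -- Both blocks have fixed lengths, so the concatenation splits uniquely; `R > 0` keeps it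
  -- nonempty.
  refine ⟨fun j g => List.ofFn (e j) ++ List.ofFn g, fun j g j' g' h => ?_, fun j g h => ?_,
    fun j g => by simp⟩
  · obtain ⟨h1, h2⟩ := List.append_inj h (by simp)
    exact ⟨e.injective (List.ofFn_injective h1), List.ofFn_injective h2⟩
  · have := congrArg List.length h
    simp at this
    omega

/-- The threshold problem over a universe whose elements have short names. -/
theorem exists_protocol_of_universe_pow {p : ℝ} (hp : 1 < p) {k n H R : ℕ} {ε τ : ℝ} (hk : 0 < k)
    (hε : 0 < ε) (hε1 : ε ≤ 1) (hτ : 1 ≤ τ) (hR : (ε / 10)⁻¹ ^ 4 ≤ R) :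
    ∃ Q : OneWayProtocol k (2 ^ H), ∀ σ : ℕ → Fin k × Fin (2 ^ H),
      Q.P.real {ω | ¬ ((∀ t ≤ n, Q.CorrectAt p ε τ ω σ t) ∧
        (Q.communication ω σ n : ℝ) ≤ (H + R) *
          (20 * reportBound p (ε / (100 * p)) ((ε / (100 * p))⁻¹ ^ 4) k R))} ≤ 3 / 20 := by
  have hp0 : 0 < p := by linarith
  set δ := ε / (100 * p) with hδ
  have hδ0 : 0 < δ := by positivity
  set L := δ⁻¹ ^ 4 with hL
  have hL0 : 0 < L := by positivity
  set T := τ ^ (1 / p) with hT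
  have hT0 : 0 < T := by positivity
  have hTp : T ^ p = τ := by
    rw [hT, ← Real.rpow_mul (by linarith), one_div, inv_mul_cancel₀ hp0.ne', Real.rpow_one]
  set e := ε / 10 with he
  have he0 : 0 < e := by positivity
  have hR0 : 0 < R := by
    have : (0 : ℝ) < R := lt_of_lt_of_le (by positivity) hR
    exact_mod_cast this
  -- The choice of `R` gives `e ^ 3 * R ≥ e⁻¹ ≥ 10`, and `exp 8 = (exp 4) ^ 2 ≥ 25`.
  have hexp3 : Real.exp (-(e ^ 3 * R)) ≤ 1 / 20 := by
    have h1 : e⁻¹ ≤ e ^ 3 * R := by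
      refine le_trans (le_of_eq ?_) (mul_le_mul_of_nonneg_left hR (by positivity))
      field_simp
    have h2 : 10 ≤ e⁻¹ := by
      rw [le_inv_comm₀ (by norm_num) he0]; linarith
    rw [Real.exp_neg, inv_le_comm₀ (Real.exp_pos _) (by norm_num)]
    have h3 : Real.exp (4 + 4) ≤ Real.exp (e ^ 3 * R) := Real.exp_le_exp.2 (by linarith)
    rw [Real.exp_add] at h3
    have h4 := Real.add_one_le_exp (4 : ℝ)
    nlinarith
  have hexp2 : Real.exp (-(e ^ 2 * R)) ≤ 1 / 20 := by
    refine le_trans (Real.exp_le_exp.2 ?_) hexp3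
    have h1 : e ^ 3 ≤ e ^ 2 := pow_le_pow_of_le_one he0.le (by linarith) (by norm_num)
    have := mul_le_mul_of_nonneg_right h1 (Nat.cast_nonneg (α := ℝ) R)
    linarith
  obtain ⟨enc, hinj, hne, hlen⟩ := exists_code H R hR0
  set θ := (1 - 2 * e) * R with hθ
  refine ⟨protocol p T δ L θ k n R (2 ^ H) enc, fun σ => ?_⟩
  -- Both critical times depend on the stream only, not on the coins, so fixed-time tail bounds
  -- apply to them.
  obtain ⟨t₀, ht₀, hF₀, hlast⟩ := exists_last_Fp_lt σ (p := p) (b := τ / (1 + ε)) hp0.ne'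
    (by positivity) n
  obtain ⟨t₁, ht₁, hfirst, hend, hF₁⟩ := exists_first_lt_Fp σ hp0 hτ n
  set B := 20 * reportBound p δ L k R with hB
  set B₀ : Set (Fin R × Fin (2 ^ H) → Block k n) :=
    {ω | θ ≤ detections p T δ L σ t₀ ω} with hB₀
  -- The conjunct `τ < Fp p σ t₁` makes this event empty if the threshold is never crossed, when
  -- `t₁` is merely the end of the stream.
  set B₁ : Set (Fin R × Fin (2 ^ H) → Block k n) :=
    {ω | τ < Fp p σ t₁ ∧ detections p T δ L σ t₁ ω ≤ θ} with hB₁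
  set B₂ : Set (Fin R × Fin (2 ^ H) → Block k n) :=
    {ω | B ≤ reports p T δ L σ t₁ ω} with hB₂
  have hm0 : (copiesMeasure k n R (2 ^ H)).real B₀ ≤ 1 / 20 :=
    (detections_ge_unlikely σ he0 (by linarith)
      (sum_blockDetect_le σ hp hT0 hδ0 hL hε hε1 hδ (by rwa [hTp]))).trans hexp2
  have hm1 : (copiesMeasure k n R (2 ^ H)).real B₁ ≤ 1 / 20 := by
    by_cases h : τ < Fp p σ t₁
    · refine (measureReal_mono fun ω hω => hω.2).trans ((detections_le_unlikely σ he0 (by linarith)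
        (le_sum_blockDetect σ hk hp hT0 hδ0 hL hε1 ?_ ht₁ (by rwa [hTp]))).trans hexp3)
      rw [hδ]
      refine div_le_div_of_nonneg_left hε.le (by norm_num) ?_
      linarith
    · have : B₁ = ∅ := by
        ext ω
        simp only [Set.mem_empty_iff_false, iff_false]
        exact fun h' => h h'.1
      rw [this, measureReal_empty]; norm_num
  have hm2 : (copiesMeasure k n R (2 ^ H)).real B₂ ≤ 1 / 20 :=
    reports_ge_unlikely σ hk hR0 hp hT0 hδ0 hL0 ht₁ (by rwa [hTp])
  have hsub : {ω : (protocol p T δ L θ k n R (2 ^ H) enc).Ω |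
      ¬ ((∀ t ≤ n, (protocol p T δ L θ k n R (2 ^ H) enc).CorrectAt p ε τ ω σ t) ∧
        ((protocol p T δ L θ k n R (2 ^ H) enc).communication ω σ n : ℝ) ≤ (H + R) * B)} ⊆
      B₀ ∪ B₁ ∪ B₂ := by
    intro ω hω
    by_contra hcon
    have h0 : ¬ θ ≤ detections p T δ L σ t₀ ω := fun h => hcon (Or.inl (Or.inl h))
    have h1 : τ < Fp p σ t₁ → θ ≤ detections p T δ L σ t₁ ω := fun h => by
      by_contra h'
      exact hcon (Or.inl (Or.inr ⟨h, (not_le.1 h').le⟩))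
    have h2 : (reports p T δ L σ t₁ ω : ℝ) ≤ B := by
      by_contra h'
      exact hcon (Or.inr (not_le.1 h').le)
    refine hω ⟨fun t ht => ⟨fun h => ?_, fun h => ?_⟩, ?_⟩
    · rw [protocol_output ω σ hinj hne ht]
      obtain ⟨h3, h4⟩ := hfirst t ht h
      exact (h1 h4).trans (Nat.cast_le.2 (detections_mono σ ω h3))
    · rw [← Bool.not_eq_true, protocol_output ω σ hinj hne ht]
      exact fun h3 => h0 (h3.trans (Nat.cast_le.2 (detections_mono σ ω (hlast t ht h))))
    · have h3 := protocol_communication_le (θ := θ) ω σ hlen (t₁ := t₁) fun t h4 h5 => by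
        rw [protocol_output ω σ hinj hne h5.le]
        exact (h1 (hend (h4.trans_lt h5))).trans (Nat.cast_le.2 (detections_mono σ ω h4))
      calc _ ≤ (((H + R) * reports p T δ L σ t₁ ω : ℕ) : ℝ) := Nat.cast_le.2 h3
        _ = (H + R) * (reports p T δ L σ t₁ ω : ℝ) := by push_cast; ring
        _ ≤ _ := mul_le_mul_of_nonneg_left h2 (by positivity)
  change (copiesMeasure k n R (2 ^ H)).real _ ≤ _
  calc _ ≤ (copiesMeasure k n R (2 ^ H)).real (B₀ ∪ B₁ ∪ B₂) := measureReal_mono hsub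
    _ ≤ _ := measureReal_union_le _ _
    _ ≤ _ := add_le_add_left (measureReal_union_le _ _) _
    _ ≤ _ := by linarith

end Existence

/-! ### Reducing the universe by a random hash function. -/

section Hashing

variable {k m M n : ℕ}

/-- The stream over the hashed universe. -/
def hashStream (g : Fin m → Fin M) (σ : ℕ → Fin k × Fin m) : ℕ → Fin k × Fin M :=
  fun t => ((σ t).1, g (σ t).2)

lemma localStream_hashStream (g : Fin m → Fin M) (σ : ℕ → Fin k × Fin m) (t : ℕ) (i : Fin k) :
    localStream (hashStream g σ) t i = (localStream σ t i).map g := by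
  induction t with
  | zero => simp [localStream]
  | succ t ih =>
    unfold localStream at ih ⊢
    rw [List.range_succ, List.map_append, List.filter_append, List.map_append, ih, List.map_append,
      List.filter_append, List.map_append, List.map_append]
    congr 1
    by_cases h : (σ t).1 = i <;> simp [hashStream, h]

lemma sum_vec_eq_card (σ : ℕ → Fin k × Fin m) (t : ℕ) (j : Fin m) :
    ∑ i, vec σ t i j = ((Finset.range t).filter fun s => (σ s).2 = j).card := by
  induction t with
  | zero => simp [vec_zero]
  | succ t ih =>
    rw [sum_vec_succ, ih, Finset.card_filter, Finset.card_filter, Finset.sum_range_succ]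

/-- Only coordinates occurring in the stream matter; the hash function is injective on these, and
all other cells contribute `0 ^ p = 0`. -/
lemma Fp_hashStream {p : ℝ} (hp : p ≠ 0) (g : Fin m → Fin M) (σ : ℕ → Fin k × Fin m) {t : ℕ}
    (ht : t ≤ n) (hg : ∀ s < n, ∀ s' < n, g (σ s).2 = g (σ s').2 → (σ s).2 = (σ s').2) :
    Fp p (hashStream g σ) t = Fp p σ t := by
  classical
  set J := (Finset.range t).image fun s => (σ s).2 with hJ
  have hinj : Set.InjOn g J := by
    intro a ha b hb h
    simp only [hJ, Finset.coe_image, Set.mem_image, Finset.mem_coe, Finset.mem_range] at ha hb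
    obtain ⟨s, hs, rfl⟩ := ha
    obtain ⟨s', hs', rfl⟩ := hb
    exact hg s (by omega) s' (by omega) h
  unfold Fp
  simp_rw [sum_vec_eq_card]
  rw [← Finset.sum_subset (Finset.subset_univ (J.image g)), Finset.sum_image hinj,
    ← Finset.sum_subset (Finset.subset_univ J)]
  · refine Finset.sum_congr rfl fun j hj => ?_
    congr 3
    ext s
    rw [Finset.mem_filter, Finset.mem_filter, Finset.mem_range]
    constructor
    · rintro ⟨hs, h⟩
      exact ⟨hs, hinj (Finset.mem_image_of_mem (fun s => (σ s).2) (Finset.mem_range.2 hs)) hj h⟩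
    · rintro ⟨hs, h⟩
      exact ⟨hs, congrArg g h⟩
  · intro j _ hj
    rw [Finset.filter_eq_empty_iff.2 fun s hs h => hj (Finset.mem_image.2 ⟨s, hs, h⟩)]
    simp [hp]
  · intro j _ hj
    have h : ((Finset.range t).filter fun s => (hashStream g σ s).2 = j) = ∅ :=
      Finset.filter_eq_empty_iff.2 fun s hs h => hj (Finset.mem_image.2
        ⟨(σ s).2, Finset.mem_image.2 ⟨s, hs, rfl⟩, h⟩)
    rw [h]
    simp [hp]

/-- The uniform distribution of a hash function. -/
noncomputable def hashMeasure (m M : ℕ) [NeZero M] : Measure (Fin m → Fin M) :=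
  Measure.pi fun _ => (PMF.uniformOfFintype (Fin M)).toMeasure

variable [NeZero M]

instance : IsProbabilityMeasure (hashMeasure m M) := by
  unfold hashMeasure; infer_instance

lemma hashMeasure_collision_le {a b : Fin m} (hab : a ≠ b) :
    (hashMeasure m M).real {g | g a = g b} ≤ 1 / M := by
  have hM : (M : ℝ) ≠ 0 := by exact_mod_cast NeZero.ne M
  have hsing : ∀ (x : Fin m) (c : Fin M),
      (hashMeasure m M) ((fun g => g x) ⁻¹' {c}) = (M : ENNReal)⁻¹ := by
    intro x c
    have h := (measurePreserving_eval
      (fun _ : Fin m => (PMF.uniformOfFintype (Fin M)).toMeasure) x).measure_preimage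
      (MeasurableSet.singleton c).nullMeasurableSet
    rw [PMF.toMeasure_apply_singleton _ _ (MeasurableSet.singleton c),
      PMF.uniformOfFintype_apply, Fintype.card_fin] at h
    exact h
  have hind : ProbabilityTheory.IndepFun (fun g : Fin m → Fin M => g a) (fun g => g b)
      (hashMeasure m M) :=
    (ProbabilityTheory.iIndepFun_pi (X := fun (_ : Fin m) (c : Fin M) => c)
      (μ := fun _ => (PMF.uniformOfFintype (Fin M)).toMeasure)
      fun _ => aemeasurable_id).indepFun hab
  have hsub : {g : Fin m → Fin M | g a = g b} ⊆
      ⋃ c ∈ (Finset.univ : Finset (Fin M)), (fun g => g a) ⁻¹' {c} ∩ (fun g => g b) ⁻¹' {c} := by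
    intro g hg
    have hg' : g a = g b := hg
    simp only [Set.mem_iUnion]
    exact ⟨g b, Finset.mem_univ _, hg', rfl⟩
  refine (measureReal_mono hsub (measure_ne_top _ _)).trans ((measureReal_biUnion_finset_le _ _).trans (le_of_eq ?_))
  have : ∀ c : Fin M, (hashMeasure m M).real
      ((fun g => g a) ⁻¹' {c} ∩ (fun g => g b) ⁻¹' {c}) = (M : ℝ)⁻¹ * (M : ℝ)⁻¹ := by
    intro c
    rw [measureReal_def, hind.measure_inter_preimage_eq_mul _ _ (MeasurableSet.singleton c)
      (MeasurableSet.singleton c), hsing, hsing]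
    simp
  simp_rw [this]
  simp [hM]

lemma hashMeasure_collisions_le (σ : ℕ → Fin k × Fin m) (n : ℕ) :
    (hashMeasure m M).real {g | ¬ ∀ s < n, ∀ s' < n, g (σ s).2 = g (σ s').2 →
      (σ s).2 = (σ s').2} ≤ (n : ℝ) ^ 2 / M := by
  classical
  have hsub : {g : Fin m → Fin M | ¬ ∀ s < n, ∀ s' < n, g (σ s).2 = g (σ s').2 →
      (σ s).2 = (σ s').2} ⊆ ⋃ x ∈ (Finset.range n ×ˢ Finset.range n).filter
        (fun x => (σ x.1).2 ≠ (σ x.2).2), {g | g (σ x.1).2 = g (σ x.2).2} := by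
    intro g hg
    have hg' : ¬ ∀ s < n, ∀ s' < n, g (σ s).2 = g (σ s').2 → (σ s).2 = (σ s').2 := hg
    push Not at hg'
    obtain ⟨s, hs, s', hs', h1, h2⟩ := hg'
    simp only [Set.mem_iUnion]
    refine ⟨(s, s'), ?_, h1⟩
    simp [hs, hs', h2]
  refine (measureReal_mono hsub (measure_ne_top _ _)).trans ((measureReal_biUnion_finset_le _ _).trans ?_)
  refine (Finset.sum_le_card_nsmul _ _ (1 / (M : ℝ)) fun x hx =>
    hashMeasure_collision_le (Finset.mem_filter.1 hx).2).trans ?_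
  rw [nsmul_eq_mul, mul_one_div]
  refine div_le_div_of_nonneg_right ?_ (Nat.cast_nonneg _)
  have := Finset.card_filter_le (Finset.range n ×ˢ Finset.range n)
    (fun x => (σ x.1).2 ≠ (σ x.2).2)
  rw [Finset.card_product, Finset.card_range, ← sq] at this
  exact_mod_cast this

/-- The protocol that runs `Q` on the hashed stream. -/
noncomputable def hashProtocol (Q : OneWayProtocol k M) (m : ℕ) : OneWayProtocol k m where
  Ω := (Fin m → Fin M) × Q.Ω
  P := (hashMeasure m M).prod Q.P
  send ω i h := Q.send ω.2 i (h.map ω.1)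
  decide1 ω S := Q.decide1 ω.2 S
  measurableSet_send i h w := by
    have : {ω : (Fin m → Fin M) × Q.Ω | Q.send ω.2 i (h.map ω.1) = w} =
        ⋃ g : Fin m → Fin M, {g} ×ˢ {ω | Q.send ω i (h.map g) = w} := by
      ext ⟨g, ω⟩
      simp only [Set.mem_iUnion, Set.mem_prod, Set.mem_singleton_iff]
      exact ⟨fun h' => ⟨g, rfl, h'⟩, fun ⟨g', h1, h2⟩ => by subst h1; exact h2⟩
    rw [this]
    exact MeasurableSet.iUnion fun g =>
      (MeasurableSet.singleton g).prod (Q.measurableSet_send i (h.map g) w)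
  measurableSet_decide1 S := measurable_snd (Q.measurableSet_decide1 S)

variable (Q : OneWayProtocol k M) (g : Fin m → Fin M) (ω : Q.Ω) (σ : ℕ → Fin k × Fin m)

lemma hashProtocol_message (t : ℕ) :
    (hashProtocol Q m).message (g, ω) σ t = Q.message ω (hashStream g σ) t := by
  unfold OneWayProtocol.message
  rw [localStream_hashStream]
  rfl

lemma hashProtocol_received (t : ℕ) :
    (hashProtocol Q m).received (g, ω) σ t = Q.received ω (hashStream g σ) t := by
  unfold OneWayProtocol.received
  congr 2
  exact funext fun s => Prod.ext rfl (hashProtocol_message Q g ω σ s)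

lemma hashProtocol_output (t : ℕ) :
    (hashProtocol Q m).output (g, ω) σ t = Q.output ω (hashStream g σ) t := by
  unfold OneWayProtocol.output
  congr 1
  exact funext fun s => congrArg (Q.decide1 ω) (hashProtocol_received Q g ω σ s)

lemma hashProtocol_communication (n : ℕ) :
    (hashProtocol Q m).communication (g, ω) σ n = Q.communication ω (hashStream g σ) n := by
  unfold OneWayProtocol.communication
  refine Finset.sum_congr rfl fun t _ => ?_
  rw [hashProtocol_message, hashProtocol_output]

/-- Slicing over the finite first factor replaces Fubini, so `S` need not be measurable. -/
lemma measureReal_prod_le {α Ω : Type*} [Fintype α] [MeasurableSpace α]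
    [MeasurableSingletonClass α] [MeasurableSpace Ω] (μ : Measure α) [IsProbabilityMeasure μ]
    (P : Measure Ω) [IsProbabilityMeasure P] {S : Set (α × Ω)} {c : ℝ}
    (h : ∀ a, P.real (Prod.mk a ⁻¹' S) ≤ c) : (μ.prod P).real S ≤ c := by
  have hsub : S ⊆ ⋃ a ∈ (Finset.univ : Finset α), {a} ×ˢ (Prod.mk a ⁻¹' S) := by
    rintro ⟨a, ω⟩ hx
    simp only [Set.mem_iUnion]
    exact ⟨a, Finset.mem_univ _, rfl, hx⟩
  calc _ ≤ _ := measureReal_mono hsub (measure_ne_top _ _)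
    _ ≤ ∑ a : α, (μ.prod P).real ({a} ×ˢ (Prod.mk a ⁻¹' S)) := measureReal_biUnion_finset_le _ _
    _ ≤ ∑ a : α, μ.real {a} * c := by
        refine Finset.sum_le_sum fun a _ => ?_
        rw [measureReal_prod_prod]
        exact mul_le_mul_of_nonneg_left (h a) measureReal_nonneg
    _ = c := by
        rw [← Finset.sum_mul, sum_measureReal_singleton]
        simp

/-- Without a collision the hashed stream has the same `F_p` at all times up to `n`, so a failure is
a collision or a failure of `Q` on the hashed stream. For a fixed hash function the hashed stream is
again oblivious, so `hQ` applies on each slice. -/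
lemma hashProtocol_bad_le {p ε τ b c : ℝ} (hp : p ≠ 0) (hc : 0 ≤ c)
    (hQ : ∀ σ : ℕ → Fin k × Fin M, Q.P.real {ω | ¬ ((∀ t ≤ n, Q.CorrectAt p ε τ ω σ t) ∧
      (Q.communication ω σ n : ℝ) ≤ b)} ≤ c) :
    (hashProtocol Q m).P.real {ω | ¬ ((∀ t ≤ n, (hashProtocol Q m).CorrectAt p ε τ ω σ t) ∧
      ((hashProtocol Q m).communication ω σ n : ℝ) ≤ b)} ≤ (n : ℝ) ^ 2 / M + c := by
  set B : Set (Fin m → Fin M) := {g | ¬ ∀ s < n, ∀ s' < n, g (σ s).2 = g (σ s').2 →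
      (σ s).2 = (σ s').2} with hB
  set S : Set ((Fin m → Fin M) × Q.Ω) := {x | x.1 ∉ B ∧
    ¬ ((∀ t ≤ n, Q.CorrectAt p ε τ x.2 (hashStream x.1 σ) t) ∧
      (Q.communication x.2 (hashStream x.1 σ) n : ℝ) ≤ b)} with hS
  have hsub : {ω : (hashProtocol Q m).Ω |
      ¬ ((∀ t ≤ n, (hashProtocol Q m).CorrectAt p ε τ ω σ t) ∧
        ((hashProtocol Q m).communication ω σ n : ℝ) ≤ b)} ⊆ B ×ˢ Set.univ ∪ S := by
    rintro ⟨g, ω⟩ hx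
    by_cases hg : g ∈ B
    · exact Or.inl ⟨hg, trivial⟩
    · refine Or.inr ⟨hg, fun hgood => hx ⟨fun t ht => ?_, ?_⟩⟩
      · have hg' := not_not.1 hg
        have h := hgood.1 t ht
        unfold OneWayProtocol.CorrectAt at h ⊢
        rw [hashProtocol_output, ← Fp_hashStream hp g σ ht hg']
        exact h
      · rw [hashProtocol_communication]
        exact hgood.2
  have h1 : ((hashMeasure m M).prod Q.P).real (B ×ˢ Set.univ) ≤ (n : ℝ) ^ 2 / M := by
    rw [measureReal_prod_prod, probReal_univ, mul_one]
    exact hashMeasure_collisions_le σ n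
  have h2 : ((hashMeasure m M).prod Q.P).real S ≤ c := by
    refine measureReal_prod_le _ _ fun g => ?_
    by_cases hg : g ∈ B
    · have : Prod.mk g ⁻¹' S = (∅ : Set Q.Ω) := by
        ext ω
        simp only [Set.mem_empty_iff_false, iff_false]
        exact fun h => h.1 hg
      rw [this, measureReal_empty]
      exact hc
    · exact (measureReal_mono fun ω h => h.2).trans (hQ (hashStream g σ))
  change ((hashMeasure m M).prod Q.P).real _ ≤ _
  exact (measureReal_mono hsub).trans ((measureReal_union_le _ _).trans (add_le_add h1 h2))

end Hashing

/-! ### Thresholds below `1`. -/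

section SmallThreshold

variable {k m : ℕ}

/-- The protocol for thresholds below `1`: the coordinator outputs `1` upon the first update. -/
noncomputable def alarmProtocol (k m : ℕ) : OneWayProtocol k m where
  Ω := Unit
  P := Measure.dirac ()
  send _ _ _ := [true]
  decide1 _ S := !S.isEmpty
  measurableSet_send _ _ _ := MeasurableSet.of_discrete
  measurableSet_decide1 _ := MeasurableSet.of_discrete

lemma alarmProtocol_output (ω : (alarmProtocol k m).Ω) (σ : ℕ → Fin k × Fin m) (t : ℕ) :
    (alarmProtocol k m).output ω σ t = decide (0 < t) := by
  have h : ∀ s, (alarmProtocol k m).decide1 ω ((alarmProtocol k m).received ω σ s) =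
      decide (0 < s) := by
    intro s
    rcases s with _ | s
    · rfl
    · rw [received_succ, if_neg (by simp [OneWayProtocol.message, alarmProtocol])]
      simp [alarmProtocol]
  unfold OneWayProtocol.output
  rw [Bool.eq_iff_iff, List.any_eq_true]
  simp only [h, decide_eq_true_eq, List.mem_range]
  exact ⟨fun ⟨s, h1, h2⟩ => by omega, fun h' => ⟨t, by omega, h'⟩⟩

lemma alarmProtocol_communication_le (ω : (alarmProtocol k m).Ω) (σ : ℕ → Fin k × Fin m) (n : ℕ) :
    (alarmProtocol k m).communication ω σ n ≤ 1 := by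
  unfold OneWayProtocol.communication
  calc _ = ∑ t ∈ Finset.range n, if t = 0 then 1 else 0 := by
        refine Finset.sum_congr rfl fun t _ => ?_
        rw [alarmProtocol_output]
        rcases t with _ | t <;> simp [OneWayProtocol.message, alarmProtocol]
    _ ≤ 1 := by
        rw [Finset.sum_ite_eq']
        split_ifs <;> simp

lemma one_le_Fp {p : ℝ} (hp : 0 ≤ p) (σ : ℕ → Fin k × Fin m) {t : ℕ} (ht : 0 < t) :
    1 ≤ Fp p σ t := by
  refine le_trans ?_ (Fp_mono σ hp (show 1 ≤ t from ht))
  refine le_trans ?_ (Finset.single_le_sum (f := fun j => ((∑ i, vec σ 1 i j : ℕ) : ℝ) ^ p)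
    (fun j _ => by positivity) (Finset.mem_univ (σ 0).2))
  refine Real.one_le_rpow ?_ hp
  have h := sum_vec_succ σ 0 (σ 0).2
  rw [if_pos rfl] at h
  exact_mod_cast (show 1 ≤ ∑ i, vec σ 1 i (σ 0).2 by rw [zero_add] at h; omega)

/-- Counts are integers, so `F_p` jumps from `0` to `1` with the first update and never takes a
value strictly between. -/
lemma alarmProtocol_correctAt {p ε τ : ℝ} (hp : 0 < p) (hε : 0 < ε) (hτ : 0 < τ) (hτ1 : τ < 1)
    (ω : (alarmProtocol k m).Ω) (σ : ℕ → Fin k × Fin m) (t : ℕ) :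
    (alarmProtocol k m).CorrectAt p ε τ ω σ t := by
  unfold OneWayProtocol.CorrectAt
  rw [alarmProtocol_output]
  rcases Nat.eq_zero_or_pos t with rfl | ht
  · rw [Fp_zero σ hp.ne']
    exact ⟨fun h => absurd h (not_lt.2 hτ.le), fun _ => rfl⟩
  · refine ⟨fun _ => by simpa using ht, fun h => ?_⟩
    have h1 := one_le_Fp hp.le σ ht
    have h2 : τ / (1 + ε) < 1 := by rw [div_lt_one (by linarith)]; linarith
    linarith

end SmallThreshold

/-! ### Constants and the final bound. -/

/-- The constant in the communication bound. -/
noncomputable def commConst (p : ℝ) : ℝ :=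
  20 * 10010 * 10001 * (100 * p) ^ 4 * (p / (p - 1)) * (100 * p) ^ (p - 1) * (2 ^ p + 1)

/-- The exponent `12 + ⌈p⌉₊` collects a fourth power each from the message length `H + R`, the
number of copies `R` and the sample size `L`, and `⌈p⌉₊` from `δ⁻¹ ^ (p - 1)`. -/
lemma communication_bound {p ε l : ℝ} (hp : 1 < p) (hε : 0 < ε) (hε1 : ε ≤ 1) (hl : 1 ≤ l)
    {k H R : ℕ} (hH : (H : ℝ) ≤ 9 * l) (hR : (R : ℝ) ≤ (ε / 10)⁻¹ ^ 4 + 1) :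
    (H + R) * (20 * reportBound p (ε / (100 * p)) ((ε / (100 * p))⁻¹ ^ 4) k R) ≤
      commConst p * (k : ℝ) ^ (p - 1) * (ε⁻¹ * l) ^ (12 + ⌈p⌉₊) := by
  have hp0 : 0 < p := by linarith
  have hp1 : 0 < p - 1 := by linarith
  set y := ε⁻¹ with hy
  have hy1 : 1 ≤ y := (one_le_inv₀ hε).2 hε1
  set x := y * l with hx
  have hlx : l ≤ x := le_mul_of_one_le_left (by linarith) hy1
  have hyx : y ≤ x := le_mul_of_one_le_right (by linarith) hl
  have hx1 : 1 ≤ x := hy1.trans hyx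
  have hx0 : 0 < x := by linarith
  have hx4 : x ≤ x ^ 4 := le_self_pow₀ hx1 (by norm_num)
  have hδ : (ε / (100 * p))⁻¹ = 100 * p * y := by rw [hy]; field_simp
  have hR' : (R : ℝ) ≤ 10001 * x ^ 4 := by
    have h1 : (ε / 10)⁻¹ ^ 4 = 10000 * y ^ 4 := by rw [hy]; field_simp; norm_num
    have h2 : y ^ 4 ≤ x ^ 4 := by gcongr
    have h3 : 1 ≤ x ^ 4 := hx1.trans hx4
    rw [h1] at hR
    linarith
  have hHR : (H : ℝ) + R ≤ 10010 * x ^ 4 := by linarith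
  have hpow : (100 * p * y) ^ (p - 1) ≤ (100 * p) ^ (p - 1) * x ^ ⌈p⌉₊ := by
    rw [Real.mul_rpow (by positivity) (by positivity)]
    refine mul_le_mul_of_nonneg_left ?_ (by positivity)
    calc y ^ (p - 1) ≤ x ^ (p - 1) := Real.rpow_le_rpow (by positivity) hyx hp1.le
      _ ≤ x ^ (⌈p⌉₊ : ℝ) := Real.rpow_le_rpow_of_exponent_le hx1 (by linarith [Nat.le_ceil p])
      _ = x ^ ⌈p⌉₊ := Real.rpow_natCast _ _
  unfold reportBound
  rw [hδ]
  calc _ ≤ (10010 * x ^ 4) * (20 * ((10001 * x ^ 4) * (100 * p * x) ^ 4 * (p / (p - 1)) *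
        ((100 * p) ^ (p - 1) * x ^ ⌈p⌉₊) * (2 ^ p + 1) * (k : ℝ) ^ (p - 1))) := by
        gcongr
    _ = _ := by
        unfold commConst
        rw [pow_add]
        ring

lemma two_pow_log_bounds {n : ℕ} (hn : 2 ≤ n) :
    ((2 * Nat.log 2 n + 7 : ℕ) : ℝ) ≤ 9 * Real.logb 2 n ∧
      (n : ℝ) ^ 2 / ((2 ^ (2 * Nat.log 2 n + 7) : ℕ) : ℝ) ≤ 1 / 20 := by
  constructor
  · have h1 := Real.natLog_le_logb n 2
    have h2 : 1 ≤ Nat.log 2 n := Nat.log_pos one_lt_two hn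
    have h3 : (1 : ℝ) ≤ Nat.log 2 n := by exact_mod_cast h2
    push_cast at h1 ⊢
    linarith
  · rw [div_le_iff₀ (by positivity)]
    have h1 : n < 2 ^ (Nat.log 2 n + 1) := Nat.lt_pow_succ_log_self one_lt_two n
    have h2 : (n : ℝ) ^ 2 ≤ (2 ^ (Nat.log 2 n + 1)) ^ 2 := by
      gcongr
      exact_mod_cast h1.le
    push_cast
    -- Of the summand `7`, two units round `n` up to a power of two and the other five give the
    -- factor `32 ≥ 20`.
    have h3 : (2 : ℝ) ^ (2 * Nat.log 2 n + 7) = 32 * (2 ^ (Nat.log 2 n + 1)) ^ 2 := by ring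
    have h4 : (0 : ℝ) < (2 ^ (Nat.log 2 n + 1)) ^ 2 := by positivity
    rw [h3]
    linarith

/-- Subadditivity alone gives this direction, so the event need not be measurable. -/
lemma le_measureReal_of_not {Ω : Type*} [MeasurableSpace Ω] (P : Measure Ω)
    [IsProbabilityMeasure P] {A : Ω → Prop} {c : ℝ} (h : P.real {ω | ¬ A ω} ≤ c) :
    1 - c ≤ P.real {ω | A ω} := by
  have h1 : (Set.univ : Set Ω) = {ω | A ω} ∪ {ω | ¬ A ω} := by
    ext ω
    exact ⟨fun _ => em (A ω), fun _ => trivial⟩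
  have h2 := measureReal_union_le (μ := P) {ω | A ω} {ω | ¬ A ω}
  rw [← h1, probReal_univ] at h2
  linarith

end FpTracking

open FpTracking in
theorem mainTheorem3 (p : ℝ) (hp : 1 < p) :
    ∃ (C : ℝ) (c : ℕ), 0 < C ∧
      ∀ (k m n : ℕ) (ε τ : ℝ), 1 ≤ k → 2 ≤ n → 0 < ε → ε ≤ 1 → 0 < τ →
        ∃ Q : FpTracking.OneWayProtocol k m,
          ∀ σ : ℕ → Fin k × Fin m,
            2 / 3 ≤ Q.P.real {ω | (∀ t ≤ n, Q.CorrectAt p ε τ ω σ t) ∧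
              (Q.communication ω σ n : ℝ) ≤
                C * (k : ℝ) ^ (p - 1) * (ε⁻¹ * Real.logb 2 n) ^ c} := by
  -- The maximum with `1` makes room for the single bit sent when `τ < 1`.
  refine ⟨max 1 (commConst p), 12 + ⌈p⌉₊, by positivity, fun k m n ε τ hk hn hε hε1 hτ => ?_⟩
  have hp0 : 0 < p := by linarith
  have hl : 1 ≤ Real.logb 2 n := by
    rw [Real.le_logb_iff_rpow_le one_lt_two (by positivity), Real.rpow_one]
    exact_mod_cast hn
  have hx1 : 1 ≤ ε⁻¹ * Real.logb 2 n := one_le_mul_of_one_le_of_one_le ((one_le_inv₀ hε).2 hε1) hl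
  have hk1 : 1 ≤ (k : ℝ) ^ (p - 1) :=
    Real.one_le_rpow (by exact_mod_cast hk) (by linarith)
  rcases lt_or_ge τ 1 with hτ1 | hτ1
  · refine ⟨alarmProtocol k m, fun σ => ?_⟩
    have h1 : (1 : ℝ) ≤ max 1 (commConst p) * (k : ℝ) ^ (p - 1) *
        (ε⁻¹ * Real.logb 2 n) ^ (12 + ⌈p⌉₊) :=
      one_le_mul_of_one_le_of_one_le (one_le_mul_of_one_le_of_one_le (le_max_left _ _) hk1)
        (one_le_pow₀ hx1)
    refine le_trans (by norm_num) (le_measureReal_of_not (c := 0) _ ?_)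
    refine le_of_eq_of_le (congrArg _ (Set.eq_empty_of_forall_notMem fun ω h => ?_))
      MeasureTheory.measureReal_empty.le
    refine h ⟨fun t _ => alarmProtocol_correctAt hp0 hε hτ hτ1 ω σ t, le_trans ?_ h1⟩
    exact_mod_cast alarmProtocol_communication_le ω σ n
  · set R := ⌈(ε / 10)⁻¹ ^ 4⌉₊ with hR
    set H := 2 * Nat.log 2 n + 7 with hH
    obtain ⟨hH9, hHn⟩ := two_pow_log_bounds hn
    obtain ⟨Q, hQ⟩ := exists_protocol_of_universe_pow (n := n) (H := H) (R := R) hp hk hε hε1 hτ1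
      (Nat.le_ceil _)
    have hb := communication_bound (k := k) hp hε hε1 hl hH9
      (Nat.ceil_lt_add_one (a := (ε / 10)⁻¹ ^ 4) (by positivity)).le
    have hb' := hb.trans (mul_le_mul_of_nonneg_right (mul_le_mul_of_nonneg_right
      (le_max_right 1 (commConst p)) (by positivity)) (by positivity))
    -- Failure budget: `1 / 20` for hash collisions and `3 / 20` for the protocol, together `1 / 5 <
    -- 1 / 3`.
    refine ⟨hashProtocol Q m, fun σ => le_trans ?_ (le_measureReal_of_not (c := 1 / 5) _ ?_)⟩
    · norm_num
    · have hQ' := hashProtocol_bad_le (c := 3 / 20) Q σ hp0.ne' (by norm_num) hQ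
      refine ((MeasureTheory.measureReal_mono ?_ (MeasureTheory.measure_ne_top _ _)).trans hQ').trans ?_
      · exact fun ω h h' => h ⟨h'.1, h'.2.trans hb'⟩
      · linarith
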